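/- Let $n\ge 2$, let $\mathcal R$ be a commutative domain (for example $\mathbb C$) with an invertible element $\hat q$ such that $\hat q^2$ is a primitive $m''$-th root of unity, and put $d'=\gcd(n,m'')$, $m'=m''/d'$. *Surface.* Let $\Sigma$ be an essentially bordered punctured bordered surface without interior punctures (that is, $\Sigma$ is a compact oriented surface $\overline\Sigma$ minus finitely many points, every boundary component of $\Sigma$ is an open interval, every connected component of $\Sigma$ has non-empty boundary, and all removed points lie on $\partial\overline\Sigma$) with an ideal triangulation $\mu$, i.e. $\Sigma$ is presented as a finite union of ideal triangles (the faces), some pairs of whose sides are glued reversing the orientation. Assume that on every boundary component of $\overline\Sigma$ the boundary edges of $\Sigma$ can be labelled $e_1,\dots,e_r$ consecutively along the positive orientation such that (i) for $1\le k\le\lfloor r/2\rfloor$ the edges $e_{2k-1},e_{2k}$ and an ideal arc $e_{2k-1,2k+1}$ bound a face, and (ii) if $r>1$ is odd, the arc $e_{r-2,r}$, the edge $e_r$ and a further ideal arc bound a face (in this order along the orientation); a component of $\Sigma$ that is an ideal triangle is also allowed. *Matrices.* In a face with corners $v_1,v_2,v_3$ in clockwise order and sides $e_a=v_av_{a+1}$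 (indices mod $3$), the small vertices are the points $(i,j,k)$ with integer barycentric coordinates $i,j,k\geq 0$, $i+j+k=n$, other than the corners. Let $\overline V_\mu$ be the set of small vertices of all faces, with those on glued sides identified. In one face, draw the arrows $v\to v+(1,-1,0)$, $v\to v+(0,1,-1)$, $v\to v+(-1,0,1)$ between small vertices, of weight $1$ on the boundary of the face and weight $2$ otherwise; let $\overline{\mathsf Q}_\mu$ be the sum over all faces of the signed weighted adjacency matrices. Let $\overline{\mathsf K}_{\mathbb P_3}$ be the matrix on the small vertices of one face that is invariant under cyclic permutation of the coordinates and satisfies $\overline{\mathsf K}_{\mathbb P_3}((i,j,k),(i',j',k'))=jk'+ki'+i'j$ if $i'\le i$ and $j'\ge j$. For a small vertex $u=(c_1,c_2,c_3)$ of a face $\nu$, let its skeleton be the formal sum of $u$ and the following small vertices: for each $a$ with $c_a\neq 0$, follow the path that leaves $\nu$ through its side $e_a$ and turns left in every face it enters, until it meets the boundary of $\Sigma$; whenever it enters a face through the side $e_b$ of that face (so leaving through $e_{b+1}$), take the small vertex of that face with coordinates $n-c_a,\ c_a,\ 0$ at the positions $b,b+1,b+2$. For $u,v\in\overline V_\mu$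 put $\overline{\mathsf K}_\mu(u,v)=\sum_y\overline{\mathsf K}_{\mathbb P_3}(y,v)$, where $y$ runs over the skeleton vertices of $u$ in a face containing $v$; this does not depend on the choices. Let $\overline{\mathsf P}_\mu=\overline{\mathsf K}_\mu\overline{\mathsf Q}_\mu\overline{\mathsf K}_\mu^{\,t}$. *Algebra and lattices.* Let $\overline{\mathcal A}_{\hat q}(\Sigma,\mu)$ be the quantum torus over $\mathcal R$ with generators $a_v^{\pm1}$ ($v\in\overline V_\mu$) and relations $a_ua_v=\hat q^{\,2\overline{\mathsf P}_\mu(u,v)}a_va_u$. For $\mathbf k\in\mathbb Z^{\overline V_\mu}$ let $a^{\mathbf k}$ be the Weyl normalized monomial $\hat q^{-\sum_{s<t}k_sk_t\overline{\mathsf P}_\mu(v_s,v_t)}a_{v_1}^{k_1}\cdots a_{v_N}^{k_N}$, where $\overline V_\mu=\{v_1,\dots,v_N\}$ and $k_s=\mathbf k(v_s)$. Let $\overline\Lambda_{m'}=\{\mathbf k\in\mathbb Z^{\overline V_\mu}\mid \mathbf k\overline{\mathsf K}_\mu\equiv 0 \bmod m'\}$. Let $\overline\Lambda_\partial$ be the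 set of all $\mathbf k\in\mathbb Z^{\overline V_\mu}$ that vanish at all small vertices in the interior of $\Sigma$ and whose restriction to every boundary component of $\overline\Sigma$ is as follows, with $e_1,\dots,e_r$ its edges and with the $n-1$ small vertices on each edge, both listed along the positive orientation: if $r$ is even, there is $\mathbf a\in\mathbb Z^{n-1}$ such that $\mathbf k$ restricts to $\mathbf a$ on each $e_t$ with $t$ odd and to the reversed vector $\overleftarrow{\mathbf a}$ on each $e_t$ with $t$ even; if $r$ is odd, there is $\mathbf b\in\mathbb Z^{n-1}$ with $\overleftarrow{\mathbf b}=\mathbf b$ such that $\mathbf k$ restricts to $\mathbf b$ on every $e_t$. Let $\overline\Lambda_z$ be the subgroup of $\mathbb Z^{\overline V_\mu}$ generated by $\overline\Lambda_{m'}$ and $\overline\Lambda_\partial$. **Theorem.** If $m''$ is odd, the center of the reduced $A$-quantum torus is $$\mathcal Z\big(\overline{\mathcal A}_{\hat q}(\Sigma,\mu)\big)=\mathcal R\text{-span}\{a^{\mathbf k}\mid \mathbf k\in\overline\Lambda_z\}.$$ -/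

import Mathlib

/-!
# Reduced `A`-version quantum tori of triangulated punctured bordered surfaces
-/

/-! ## Quantum tori -/

/-- The defining relations of the quantum torus of an integer matrix `P`: the generator `inr v` is a
two-sided inverse of `inl v`, and `x_u x_v = q ^ (2 P(u,v)) x_v x_u`. -/
inductive QuantumTorusRel {R : Type*} [CommRing R] {ι : Type*} (q : Rˣ) (P : Matrix ι ι ℤ) :
    FreeAlgebra R (ι ⊕ ι) → FreeAlgebra R (ι ⊕ ι) → Prop
  | mul_inv (v : ι) : QuantumTorusRel q P
      (FreeAlgebra.ι R (Sum.inl v) * FreeAlgebra.ι R (Sum.inr v)) 1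
  | inv_mul (v : ι) : QuantumTorusRel q P
      (FreeAlgebra.ι R (Sum.inr v) * FreeAlgebra.ι R (Sum.inl v)) 1
  | comm (u v : ι) : QuantumTorusRel q P
      (FreeAlgebra.ι R (Sum.inl u) * FreeAlgebra.ι R (Sum.inl v))
      (((q ^ (2 * P u v) : Rˣ) : R) •
        (FreeAlgebra.ι R (Sum.inl v) * FreeAlgebra.ι R (Sum.inl u)))

/-- The quantum torus `R⟨x_v^{±1}⟩ / (x_u x_v = q ^ (2 P(u,v)) x_v x_u)`. -/
abbrev QuantumTorus {R : Type*} [CommRing R] {ι : Type*} (q : Rˣ) (P : Matrix ι ι ℤ) : Type _ :=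
  RingQuot (QuantumTorusRel q P)

namespace QuantumTorus

variable {R : Type*} [CommRing R] {ι : Type*} (q : Rˣ) (P : Matrix ι ι ℤ)

/-- The generator `x_v`, as a unit of the quantum torus. -/
def gen (v : ι) : (QuantumTorus q P)ˣ where
  val := RingQuot.mkAlgHom R (QuantumTorusRel q P) (FreeAlgebra.ι R (Sum.inl v))
  inv := RingQuot.mkAlgHom R (QuantumTorusRel q P) (FreeAlgebra.ι R (Sum.inr v))
  val_inv := by
    rw [← map_mul, RingQuot.mkAlgHom_rel R (QuantumTorusRel.mul_inv v), map_one]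
  inv_val := by
    rw [← map_mul, RingQuot.mkAlgHom_rel R (QuantumTorusRel.inv_mul v), map_one]

/-- The Weyl normalized monomial
`x^k = q ^ (- ∑_{i<j} k_i k_j P_{ij}) x_1^{k_1} ⋯ x_m^{k_m}`
for an enumeration of the index set (for antisymmetric `P` it does not depend on the
enumeration). -/
noncomputable def weyl [Fintype ι] (k : ι → ℤ) : QuantumTorus q P :=
  let e := (Fintype.equivFin ι).symm
  ((q ^ (-∑ i, ∑ j, if i < j then k (e i) * k (e j) * P (e i) (e j) else 0) : Rˣ) : R) •
    (List.ofFn fun i => ((gen q P (e i) ^ k (e i) : (QuantumTorus q P)ˣ) : QuantumTorus q P)).prod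

end QuantumTorus

/-! ## The `n`-triangulation of one ideal triangle -/

/-- The small vertices of the `n`-triangulation of the ideal triangle: integer barycentric
coordinates `(c 0, c 1, c 2)` with sum `n`; all coordinates are `< n`, i.e. the three corners
`v_0, v_1, v_2` are left out. The corners `v_0, v_1, v_2` are in *clockwise* order, and the side
number `a` is the one with endpoints `v_a` and `v_{a+1}`, given by `c (a + 2) = 0`. -/
abbrev SmallVertex (n : ℕ) : Type := {c : ZMod 3 → Fin n // ∑ a, (c a : ℕ) = n}

namespace SmallVertex

variable {n : ℕ}

/-- The `a`-th barycentric coordinate. -/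
def coord (v : SmallVertex n) (a : ZMod 3) : ℤ := ((v.1 a : ℕ) : ℤ)

/-- The small vertex on the side `a` with coordinates `c a = i`, `c (a + 1) = n - i`. Along the
counterclockwise orientation of the triangle (which runs from `v_{a+1}` to `v_a` on the side `a`)
it is the `i`-th small vertex of this side. -/
def onSide (a : ZMod 3) (i : ℕ) (h0 : 0 < i) (hi : i < n) : SmallVertex n :=
  ⟨fun b => if b = a then ⟨i, hi⟩ else if b = a + 1 then ⟨n - i, by omega⟩ else ⟨0, by omega⟩, by
    have hs : ∀ f : ZMod 3 → ℕ, ∑ b, f b = f 0 + f 1 + f 2 := fun f => Fin.sum_univ_three f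
    rw [hs]
    have h3 : ∀ a : ZMod 3, a = 0 ∨ a = 1 ∨ a = 2 := by decide
    have e1 : (0 : ZMod 3) ≠ 1 := by decide
    have e2 : (0 : ZMod 3) ≠ 2 := by decide
    have e3 : (1 : ZMod 3) ≠ 2 := by decide
    have e4 : (1 : ZMod 3) + 1 = 2 := by decide
    have e5 : (2 : ZMod 3) + 1 = 0 := by decide
    rcases h3 a with rfl | rfl | rfl <;>
      simp [e1, e2, e3, e4, e5, e1.symm, e2.symm, e3.symm] <;> omega⟩

/-- The total weight of the arrow from `v` to `w`. The arrows are the small edges oriented parallel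
to the counterclockwise direction of a side `a`, from `v_{a+1}` to `v_a`; the weight is `1` if the
small edge lies on the boundary of the triangle, and `2` otherwise. -/
def arrowWeight (v w : SmallVertex n) : ℤ :=
  ∑ a : ZMod 3,
    if w.coord a = v.coord a + 1 ∧ w.coord (a + 1) = v.coord (a + 1) - 1 ∧
        w.coord (a + 2) = v.coord (a + 2)
    then (if v.coord (a + 2) = 0 then 1 else 2) else 0

/-- The signed adjacency matrix of the weighted quiver of one triangle. -/
def Q : Matrix (SmallVertex n) (SmallVertex n) ℤ :=
  fun v w => arrowWeight v w - arrowWeight w v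

/-- The expression `j k' + k i' + i' j` for `v = (i,j,k)`, `w = (i',j',k')`, where the coordinates
are read cyclically from the index `a` on. -/
def kForm (a : ZMod 3) (v w : SmallVertex n) : ℤ :=
  v.coord (a + 1) * w.coord (a + 2) + v.coord (a + 2) * w.coord a + w.coord a * v.coord (a + 1)

/-- The cyclically invariant matrix which equals `j k' + k i' + i' j` at `v = (i,j,k)`,
`w = (i',j',k')` if `i' ≤ i` and `j' ≥ j`. -/
def K : Matrix (SmallVertex n) (SmallVertex n) ℤ :=
  fun v w =>
    if w.coord 0 ≤ v.coord 0 ∧ v.coord 1 ≤ w.coord 1 then kForm 0 v w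
    else if w.coord 1 ≤ v.coord 1 ∧ v.coord 2 ≤ w.coord 2 then kForm 1 v w
    else kForm 2 v w

end SmallVertex

/-! ## Ideally triangulated surfaces -/

/-- An oriented punctured bordered surface with an ideal triangulation, presented as the union of
its faces: one copy of the oriented ideal triangle for each element of `F`, and an involution on the
set `F × ZMod 3` of sides. A side which is not fixed is glued, reversing the orientation, to its
image; the fixed sides are the boundary edges of the surface. The punctures are the classes of
corners of the triangles. -/
structure IdealTriangulation (F : Type*) where
  /-- the gluing of the sides of the faces -/
  glue : F × ZMod 3 → F × ZMod 3
  glue_glue : ∀ s, glue (glue s) = s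

namespace IdealTriangulation

variable {F : Type*} (T : IdealTriangulation F)

/-- The side `s` is a boundary edge of the surface. -/
def IsBoundary (s : F × ZMod 3) : Prop := T.glue s = s

/-- The side of the same face through which one leaves the face after having entered through `s` and
turned left, i.e. around the corner `v_{a+1}`, where `s` is the side number `a`. In the
counterclockwise cyclic order of the sides of the face, `s` comes directly after `left s`. -/
def left (s : F × ZMod 3) : F × ZMod 3 := (s.1, s.2 + 1)

/-- `T.LeftTurn s t`: the path which enters a face through the side `s` and turns left in every face
reaches the side `t` (as a side of the face in which it is at that moment). The path stops when it
reaches a boundary edge. -/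
inductive LeftTurn : F × ZMod 3 → F × ZMod 3 → Prop
  | start (s : F × ZMod 3) : LeftTurn s (left s)
  | step (s t : F × ZMod 3) (h : LeftTurn s t) (ht : ¬ T.IsBoundary t) :
      LeftTurn s (left (T.glue t))

/-- No puncture lies in the interior: turning left around any corner of any face one finally arrives
at a boundary edge. -/
def NoInteriorPuncture : Prop := ∀ s, ∃ t, T.LeftTurn s t ∧ T.IsBoundary t

/-- Every connected component of the surface has non-empty boundary. -/
def EssentiallyBordered : Prop :=
  ∀ f : F, ∃ s : F × ZMod 3, T.IsBoundary s ∧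
    Relation.ReflTransGen (fun g h : F => ∃ a b : ZMod 3, T.glue (g, a) = (h, b)) f s.1

/-- `e` labels by `ℤ/r` the boundary edges on one boundary component of the compactified surface
consecutively along the positive orientation; `r > 0` is then the number of punctures on this
component. The edge which follows `e t` is `e (t + 1)`: entering through `e (t + 1)` and always
turning left, i.e. going around the initial point of `e (t + 1)`, one reaches `e t`. -/
def IsBoundaryComponent (r : ℕ) (e : ZMod r → F × ZMod 3) : Prop :=
  0 < r ∧ Function.Injective e ∧ (∀ t, T.IsBoundary (e t)) ∧ ∀ t, T.LeftTurn (e (t + 1)) (e t)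

/-- The triangulation has the special form `μ` near the boundary. On every boundary component the
boundary edges can be labelled `e_1, …, e_r` along the positive orientation such that
* for `1 ≤ k ≤ ⌊r/2⌋` the edges `e_{2k-1}` and `e_{2k}` are sides of one face, and
* if `r > 1` is odd, then the third side of the face containing `e_{r-2}` and `e_{r-1}` is glued to
  a side of a face which has `e_r` as its next side; or else `r = 3` and this third side is `e_3`
  itself, which happens only for a component of the surface which is an ideal triangle. -/
def IsSpecial : Prop :=
  ∀ s, T.IsBoundary s → ∃ (r : ℕ) (e : ZMod r → F × ZMod 3),
    T.IsBoundaryComponent r e ∧ s ∈ Set.range e ∧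
    (∀ k : ℕ, 1 ≤ k → k ≤ r / 2 →
      left (e ((2 * k : ℕ) : ZMod r)) = e ((2 * k - 1 : ℕ) : ZMod r)) ∧
    (Odd r → 1 < r →
      T.glue (left (e ((r - 2 : ℕ) : ZMod r))) = left (e (r : ZMod r)) ∨
      (r = 3 ∧ left (e 1) = e 3))

/-! ### Small vertices of the surface -/

/-- The identification of the small vertices on two sides which are glued to each other. -/
inductive GlueRel (n : ℕ) : F × SmallVertex n → F × SmallVertex n → Prop
  | mk (s : F × ZMod 3) (hs : ¬ T.IsBoundary s) (i : ℕ) (h0 : 0 < i) (hi : i < n) :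
      GlueRel n (s.1, SmallVertex.onSide s.2 i h0 hi)
        ((T.glue s).1, SmallVertex.onSide (T.glue s).2 (n - i) (by omega) (by omega))

/-- The equivalence relation generated by the gluing. -/
def vertexSetoid (n : ℕ) : Setoid (F × SmallVertex n) := Relation.EqvGen.setoid (T.GlueRel n)

/-- The (reduced) set of small vertices of the `n`-triangulation of the surface. -/
abbrev Vertex (n : ℕ) : Type _ := Quotient (T.vertexSetoid n)

/-- The small vertex of the surface given by a small vertex of a face. -/
def mkVertex {n : ℕ} (x : F × SmallVertex n) : T.Vertex n := Quotient.mk (T.vertexSetoid n) x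

noncomputable instance (n : ℕ) [Finite F] : Fintype (T.Vertex n) := Fintype.ofFinite _

/-- The `i`-th small vertex on the side `s`, along the orientation of `s` induced from its face. -/
def edgeVertex {n : ℕ} (s : F × ZMod 3) (i : ℕ) (h0 : 0 < i) (hi : i < n) : T.Vertex n :=
  T.mkVertex (s.1, SmallVertex.onSide s.2 i h0 hi)

/-- The small vertex lies on the boundary of the surface. -/
def OnBoundary {n : ℕ} (x : T.Vertex n) : Prop :=
  ∃ s, T.IsBoundary s ∧ ∃ (i : ℕ) (h0 : 0 < i) (hi : i < n), x = T.edgeVertex s i h0 hi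

/-! ### The matrices -/

open Classical in
/-- The signed adjacency matrix of the surface, the sum of the zero-extensions of the matrices of
the faces. -/
noncomputable def Qbar [Fintype F] (n : ℕ) : Matrix (T.Vertex n) (T.Vertex n) ℤ :=
  fun u v => ∑ τ : F, ∑ x : SmallVertex n, ∑ y : SmallVertex n,
    if T.mkVertex (τ, x) = u ∧ T.mkVertex (τ, y) = v then SmallVertex.Q x y else 0

/-- `T.Enters s t`: a path which leaves a face through the side `s`, and then turns left in every
face, at some moment enters a face through its side `t`. -/
def Enters (s t : F × ZMod 3) : Prop :=
  (¬ T.IsBoundary s ∧ t = T.glue s) ∨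
  (¬ T.IsBoundary s ∧ ∃ t', T.LeftTurn (T.glue s) t' ∧ ¬ T.IsBoundary t' ∧ t = T.glue t')

open Classical in
/-- The skeleton in the face `τ` of the small vertex `x.2` of the face `x.1`. Its graph has the main
segment `x.2`, with a leg of weight `x.2.coord a` leaving through the side `a`, for each `a`. A leg
of nonzero weight `w` is elongated by turning left in every face; its arc segment in a face which is
entered through the side `b` (and left through the side `b + 1`) stands for the small vertex with
coordinates `n - w`, `w`, `0` at `b`, `b + 1`, `b + 2`. -/
noncomputable def skeleton {n : ℕ} (x : F × SmallVertex n) (τ : F) : SmallVertex n →₀ ℤ :=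
  (if x.1 = τ then Finsupp.single x.2 1 else 0) +
  ∑ a : ZMod 3, ∑ b : ZMod 3,
    if h : 0 < (x.2.1 a : ℕ) then
      if T.Enters (x.1, a) (τ, b) then
        Finsupp.single (SmallVertex.onSide b (n - (x.2.1 a : ℕ))
          (Nat.sub_pos_of_lt (x.2.1 a).2) (Nat.sub_lt ((Nat.zero_le _).trans_lt (x.2.1 a).2) h)) 1
      else 0
    else 0

/-- The transition matrix `K̄(u,v) = K_τ(skeleton_τ(u), v)`, where `τ` is a face containing `v` and
the skeleton is computed from a face containing `u`. (If there are no interior punctures, the value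
does not depend on the choice of these faces.) -/
noncomputable def Kbar (n : ℕ) : Matrix (T.Vertex n) (T.Vertex n) ℤ :=
  fun u v => (T.skeleton u.out v.out.1).sum fun y m => m * SmallVertex.K y v.out.2

/-- The matrix `P̄ = K̄ Q̄ K̄ᵗ`. -/
noncomputable def Pbar [Fintype F] (n : ℕ) : Matrix (T.Vertex n) (T.Vertex n) ℤ :=
  T.Kbar n * T.Qbar n * (T.Kbar n).transpose

/-- The reduced `A`-version quantum torus. -/
abbrev ReducedATorus [Fintype F] (n : ℕ) {R : Type*} [CommRing R] (q : Rˣ) : Type _ :=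
  QuantumTorus q (T.Pbar n)

/-! ### The lattices -/

/-- The vectors `k` with `k K̄ = 0` modulo `m`. -/
def LambdaMod [Fintype F] (n m : ℕ) : Set (T.Vertex n → ℤ) :=
  {k | ∀ v, (m : ℤ) ∣ Matrix.vecMul k (T.Kbar n) v}

/-- The boundary-symmetric vectors: `k` vanishes at the small vertices in the interior; on a
boundary component with an even number of edges `e_1, …, e_r`, the vector is
`(a, reversed a, a, reversed a, …)`; on a boundary component with an odd number of edges, it is
`(b, b, …, b)` with `b` symmetric. -/
def LambdaBoundary (n : ℕ) : Set (T.Vertex n → ℤ) :=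
  {k | (∀ x, ¬ T.OnBoundary x → k x = 0) ∧
    ∀ (r : ℕ) (e : ZMod r → F × ZMod 3), T.IsBoundaryComponent r e →
      (Even r → ∃ a : ℕ → ℤ, ∀ j : ℕ, 1 ≤ j → j ≤ r → ∀ (i : ℕ) (h0 : 0 < i) (hi : i < n),
        k (T.edgeVertex (e j) i h0 hi) = if Odd j then a i else a (n - i)) ∧
      (Odd r → ∃ b : ℕ → ℤ, (∀ i, 0 < i → i < n → b i = b (n - i)) ∧
        ∀ j : ℕ, 1 ≤ j → j ≤ r → ∀ (i : ℕ) (h0 : 0 < i) (hi : i < n),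
          k (T.edgeVertex (e j) i h0 hi) = b i)}

/-- The subgroup generated by `LambdaMod` and `LambdaBoundary`. -/
def LambdaZ [Fintype F] (n m : ℕ) : AddSubgroup (T.Vertex n → ℤ) :=
  AddSubgroup.closure (T.LambdaMod n m ∪ T.LambdaBoundary n)

end IdealTriangulation

/-!
# The center of the reduced `A`-version quantum torus

In the quantum torus of an antisymmetric matrix `P` the generator `x_v` commutes with the monomial
`x^k` up to the factor `q ^ (2 (P k)_v)`. The Weyl normalized monomials form a basis (they are
linearly independent because they act on the free module on the exponent vectors by translations),
so the center is spanned by the `x^k` with `m'' ∣ P k`; this is `QuantumTorus.center_eq_span`. What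
remains is to identify this set of exponents.

The core is the identity `K̄ Q̄ = n (S - 2)` (`IdealTriangulation.Kbar_mul_Qbar`), where
`S = legMatrix` counts the legs of the skeleton of `u` which end at the boundary vertex `w`. In one
triangle, `K(s, ·)` is a linear function plus `n` times a concave piecewise linear function which is
broken along three rays issuing from `s`, the legs of `s`. Multiplication by `Q` is a second
difference operator, so it kills the linear part and leaves a contribution at `s` and one for each
point where a ray meets a side (`SmallVertex.sum_K_mul_Q`). In the surface a leg which crosses a
glued side contributes once on each of the two faces, and this is cancelled by the skeleton vertex
by which it continues. Here the absence of interior punctures is needed: the legs are finite paths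
without repetitions.

Since `P̄ = K̄ Q̄ K̄ᵗ`, with `L = k K̄` one gets `P̄ k = n (S L - 2 L)`, and `m'' ∣ P̄ k` is
equivalent to `S L ≡ 2 L` modulo `m' = m'' / gcd(n, m'')`.

* If `L ≡ 0` this holds. The small vertex number `i` of a boundary edge has two legs, one ending
  there and one ending at the number `n - i` of the preceding boundary edge
  (`legMatrix_boundary`). Hence `k S = 2 k` if `k` is boundary-symmetric, so that `k P̄ = 0`, and
  `P̄ k = 0` as `P̄` is antisymmetric.
* Conversely, if `S L ≡ 2 L`, then `L` is boundary-symmetric modulo `m'` on the boundary, and its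
  values there determine it modulo `m'`, as `m'` is odd. On a boundary edge, `L` is the product of
  the restriction of `k S` with the matrix `κ(i, p) = n min(i, p) - i p`, and for a boundary-symmetric
  `k'` in place of `k` it is the product of `2 k'` with `κ`. Transporting the values of `k S`
  from one edge to all edges of its boundary component, symmetrized if the component returns to the
  edge with the reversed direction, and dividing by `2` modulo `m'` therefore gives a boundary-symmetric `k'` with
  `k' K̄ ≡ L` on the boundary (`exists_mem_LambdaBoundary`), so that `(k - k') K̄ ≡ 0` modulo `m'`.
-/

/-! ### Quantum tori -/

namespace QuantumTorus

variable {R : Type*} [CommRing R] {ι : Type*} (q : Rˣ) (P : Matrix ι ι ℤ)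

/-- The invertible scalars, as units of the quantum torus. -/
def scalar : Rˣ →* (QuantumTorus q P)ˣ :=
  Units.map (algebraMap R (QuantumTorus q P) : R →* QuantumTorus q P)

lemma scalar_mul_comm (c : Rˣ) (x : (QuantumTorus q P)ˣ) :
    scalar q P c * x = x * scalar q P c :=
  Units.ext (Algebra.commutes _ _)

lemma coe_scalar_mul (c : Rˣ) (x : (QuantumTorus q P)ˣ) :
    ((scalar q P c * x : (QuantumTorus q P)ˣ) : QuantumTorus q P) =
      (c : R) • (x : QuantumTorus q P) :=
  (Algebra.smul_def _ _).symm

lemma gen_mul_gen (u v : ι) :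
    gen q P u * gen q P v = scalar q P (q ^ (2 * P u v)) * (gen q P v * gen q P u) := by
  apply Units.ext
  rw [coe_scalar_mul]
  simp only [gen, Units.val_mul]
  rw [← map_mul, RingQuot.mkAlgHom_rel R (QuantumTorusRel.comm u v), map_smul, map_mul]

lemma subalgebra_eq_top (A : Subalgebra R (QuantumTorus q P))
    (h : ∀ v, (gen q P v : QuantumTorus q P) ∈ A)
    (h' : ∀ v, (((gen q P v)⁻¹ : (QuantumTorus q P)ˣ) : QuantumTorus q P) ∈ A) : A = ⊤ := by
  rw [eq_top_iff]
  rintro x -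
  obtain ⟨y, rfl⟩ := RingQuot.mkAlgHom_surjective R (QuantumTorusRel q P) x
  induction y using FreeAlgebra.induction with
  | grade0 r => simp
  | grade1 w =>
    rcases w with v | v
    · exact h v
    · exact h' v
  | mul a b ha hb => simpa using A.mul_mem ha hb
  | add a b ha hb => simpa using A.add_mem ha hb

/-! ### Products of powers of the generators -/

/-- The product of the powers `x_v ^ k_v`, in the order given by the list. -/
def listMonomial (l : List ι) (k : ι → ℤ) : (QuantumTorus q P)ˣ :=
  (l.map fun v => gen q P v ^ k v).prod

lemma listMonomial_cons (v : ι) (l : List ι) (k : ι → ℤ) :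
    listMonomial q P (v :: l) k = gen q P v ^ k v * listMonomial q P l k := by
  simp [listMonomial]

lemma conj_gen_zpow (u v : ι) (z : ℤ) :
    MulAut.conj (gen q P u) (gen q P v ^ z) =
      scalar q P (q ^ (2 * (z * P u v))) * gen q P v ^ z := by
  have h1 : MulAut.conj (gen q P u) (gen q P v) =
      scalar q P (q ^ (2 * P u v)) * gen q P v := by
    rw [MulAut.conj_apply, gen_mul_gen]; group
  rw [map_zpow, h1, Commute.mul_zpow (scalar_mul_comm q P _ _), ← map_zpow, ← zpow_mul]
  congr 3
  ring

lemma conj_listMonomial (u : ι) (l : List ι) (k : ι → ℤ) :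
    MulAut.conj (gen q P u) (listMonomial q P l k) =
      scalar q P (q ^ (2 * (l.map fun v => k v * P u v).sum)) * listMonomial q P l k := by
  induction l with
  | nil => simp [listMonomial]
  | cons v l ih =>
    rw [listMonomial_cons, map_mul, ih, conj_gen_zpow, List.map_cons, List.sum_cons, mul_add,
      zpow_add, map_mul, mul_assoc, mul_assoc, ← mul_assoc (gen q P v ^ k v),
      ← scalar_mul_comm q P _ (gen q P v ^ k v), mul_assoc]

/-- Products of powers of pairwise commuting elements are additive in the
exponents. -/
lemma prod_zpow_add_of_commute {G : Type*} [Group G] (g : ι → G)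
    (hg : ∀ u v, Commute (g u) (g v)) (l : List ι) (k k' : ι → ℤ) :
    (l.map fun v => g v ^ (k + k') v).prod =
      (l.map fun v => g v ^ k v).prod * (l.map fun v => g v ^ k' v).prod := by
  induction l with
  | nil => simp
  | cons v l ih =>
    have hc : Commute (g v ^ k' v) (l.map fun v => g v ^ k v).prod := by
      apply Commute.list_prod_right
      intro x hx
      obtain ⟨w, -, rfl⟩ := List.mem_map.1 hx
      exact (hg v w).zpow_zpow _ _
    rw [List.map_cons, List.prod_cons, ih, Pi.add_apply, zpow_add, List.map_cons, List.prod_cons,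
      List.map_cons, List.prod_cons, mul_assoc, ← mul_assoc (g v ^ k' v), hc.eq]
    group

instance scalar_range_normal : (scalar q P).range.Normal where
  conj_mem := by
    rintro _ ⟨c, rfl⟩ g
    exact ⟨c, by rw [← scalar_mul_comm]; group⟩

/-- Two units have the same class modulo scalars if and only if they differ by a scalar. -/
lemma mk_eq_mk_iff (x y : (QuantumTorus q P)ˣ) :
    (x : (QuantumTorus q P)ˣ ⧸ (scalar q P).range) = y ↔ ∃ c, y = scalar q P c * x := by
  rw [QuotientGroup.eq]
  constructor
  · rintro ⟨c, hc⟩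
    exact ⟨c, by rw [scalar_mul_comm, hc]; group⟩
  · rintro ⟨c, hc⟩
    exact ⟨c, by rw [hc, scalar_mul_comm]; group⟩

lemma mk_gen_commute (u v : ι) :
    Commute (gen q P u : (QuantumTorus q P)ˣ ⧸ (scalar q P).range) (gen q P v) := by
  rw [Commute, SemiconjBy, ← QuotientGroup.mk_mul, ← QuotientGroup.mk_mul, eq_comm, mk_eq_mk_iff]
  exact ⟨_, gen_mul_gen q P u v⟩

lemma mk_listMonomial (l : List ι) (k : ι → ℤ) :
    (listMonomial q P l k : (QuantumTorus q P)ˣ ⧸ (scalar q P).range) =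
      (l.map fun v => (gen q P v : (QuantumTorus q P)ˣ ⧸ (scalar q P).range) ^ k v).prod := by
  induction l with
  | nil => simp [listMonomial]
  | cons v l ih => rw [listMonomial_cons, QuotientGroup.mk_mul, ih]; simp

lemma listMonomial_add (l : List ι) (k k' : ι → ℤ) :
    ∃ c, listMonomial q P l k * listMonomial q P l k' =
      scalar q P c * listMonomial q P l (k + k') := by
  rw [← mk_eq_mk_iff, QuotientGroup.mk_mul, mk_listMonomial, mk_listMonomial, mk_listMonomial]
  exact prod_zpow_add_of_commute _ (mk_gen_commute q P) l k k'

lemma listMonomial_single [DecidableEq ι] (l : List ι) (hl : l.Nodup) (v : ι) (hv : v ∈ l) (z : ℤ) :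
    listMonomial q P l (Pi.single v z) = gen q P v ^ z := by
  induction l with
  | nil => simp at hv
  | cons w l ih =>
    rw [List.nodup_cons] at hl
    rw [listMonomial_cons]
    by_cases hvw : v = w
    · subst hvw
      have : listMonomial q P l (Pi.single v z) = 1 := by
        apply List.prod_eq_one
        intro x hx
        obtain ⟨w, hw, rfl⟩ := List.mem_map.1 hx
        have : w ≠ v := fun h => hl.1 (h ▸ hw)
        simp [this]
      simp [this]
    · have : v ∈ l := by simpa [hvw] using hv
      rw [ih hl.2 this]
      simp [Ne.symm hvw]

/-! ### The regular representation -/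

variable {P} in
lemma apply_swap (hP : P.transpose = -P) (u v : ι) : P u v = -P v u := by
  simpa using congrFun (congrFun hP v) u

variable {P} in
lemma apply_self (hP : P.transpose = -P) (v : ι) : P v v = 0 := by
  have := apply_swap hP v v
  omega

section Representation

variable [Fintype ι] [DecidableEq ι]

/-- The generator `x_v` acts on the free module on the exponent vectors by
`l ↦ q ^ (P l)_v • (l + e_v)`. -/
noncomputable def genAct (v : ι) : Module.End R ((ι → ℤ) →₀ R) :=
  Finsupp.linearCombination R fun l =>
    ((q ^ (P.mulVec l v) : Rˣ) : R) • Finsupp.single (l + Pi.single v 1) (1 : R)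

/-- The inverse of `genAct`, when `P` vanishes on the diagonal. -/
noncomputable def genInvAct (v : ι) : Module.End R ((ι → ℤ) →₀ R) :=
  Finsupp.linearCombination R fun l =>
    ((q ^ (-P.mulVec l v) : Rˣ) : R) • Finsupp.single (l - Pi.single v 1) (1 : R)

lemma genAct_single (v : ι) (l : ι → ℤ) :
    genAct q P v (Finsupp.single l (1 : R)) =
      ((q ^ (P.mulVec l v) : Rˣ) : R) • Finsupp.single (l + Pi.single v 1) (1 : R) := by
  rw [genAct, Finsupp.linearCombination_single, one_smul]

lemma genInvAct_single (v : ι) (l : ι → ℤ) :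
    genInvAct q P v (Finsupp.single l (1 : R)) =
      ((q ^ (-P.mulVec l v) : Rˣ) : R) • Finsupp.single (l - Pi.single v 1) (1 : R) := by
  rw [genInvAct, Finsupp.linearCombination_single, one_smul]

/-- The regular representation of the quantum torus of an antisymmetric matrix, on the free module
on the exponent vectors. -/
noncomputable def regularRep (hP : P.transpose = -P) :
    QuantumTorus q P →ₐ[R] Module.End R ((ι → ℤ) →₀ R) :=
  RingQuot.liftAlgHom R ⟨FreeAlgebra.lift R (Sum.elim (genAct q P) (genInvAct q P)), by
    intro x y h
    cases h with
    | mul_inv v =>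
      refine Finsupp.lhom_ext' fun l => LinearMap.ext_ring ?_
      simp only [map_mul, map_one, FreeAlgebra.lift_ι_apply, Sum.elim_inl, Sum.elim_inr,
        LinearMap.comp_apply, Finsupp.lsingle_apply, Module.End.mul_apply, Module.End.one_apply,
        map_smul, genAct_single, genInvAct_single, smul_smul, ← Units.val_mul, ← zpow_add,
        Matrix.mulVec_sub, Matrix.mulVec_single_one, Pi.sub_apply, Matrix.col_apply,
        apply_self hP]
      simp
    | inv_mul v =>
      refine Finsupp.lhom_ext' fun l => LinearMap.ext_ring ?_
      simp only [map_mul, map_one, FreeAlgebra.lift_ι_apply, Sum.elim_inl, Sum.elim_inr,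
        LinearMap.comp_apply, Finsupp.lsingle_apply, Module.End.mul_apply, Module.End.one_apply,
        map_smul, genAct_single, genInvAct_single, smul_smul, ← Units.val_mul, ← zpow_add,
        Matrix.mulVec_add, Matrix.mulVec_single_one, Pi.add_apply, Matrix.col_apply,
        apply_self hP]
      simp
    | comm u v =>
      refine Finsupp.lhom_ext' fun l => LinearMap.ext_ring ?_
      simp only [map_mul, map_smul, FreeAlgebra.lift_ι_apply, Sum.elim_inl, LinearMap.comp_apply,
        Finsupp.lsingle_apply, Module.End.mul_apply, LinearMap.smul_apply, genAct_single, smul_smul,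
        ← Units.val_mul, ← zpow_add, Matrix.mulVec_add, Matrix.mulVec_single_one, Pi.add_apply,
        Matrix.col_apply, add_right_comm l]
      rw [apply_swap hP v u]
      congr 3
      ring⟩

lemma regularRep_gen (hP : P.transpose = -P) (v : ι) :
    regularRep q P hP (gen q P v : QuantumTorus q P) = genAct q P v := by
  simp [regularRep, gen]

/-- The pairs of a unit `x` of the quantum torus and a vector `d` such that in the regular
representation `x` translates all exponent vectors by `d`, up to invertible scalars. -/
noncomputable def translations (hP : P.transpose = -P) :
    Subgroup ((QuantumTorus q P)ˣ × Multiplicative (ι → ℤ)) where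
  carrier := {x | ∀ l, ∃ c : Rˣ, regularRep q P hP (x.1 : QuantumTorus q P) (Finsupp.single l 1) =
    (c : R) • Finsupp.single (l + x.2.toAdd) (1 : R)}
  one_mem' l := ⟨1, by simp⟩
  mul_mem' {x y} hx hy l := by
    obtain ⟨c, hc⟩ := hy l
    obtain ⟨c', hc'⟩ := hx (l + y.2.toAdd)
    refine ⟨c * c', ?_⟩
    simp only [Prod.fst_mul, Units.val_mul, map_mul, Module.End.mul_apply, hc, map_smul, hc',
      smul_smul, Prod.snd_mul, toAdd_mul]
    rw [add_assoc, add_comm y.2.toAdd]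
  inv_mem' {x} hx l := by
    obtain ⟨c, hc⟩ := hx (l - x.2.toAdd)
    refine ⟨c⁻¹, ?_⟩
    rw [sub_add_cancel] at hc
    have h : Finsupp.single l (1 : R) = ((c⁻¹ : Rˣ) : R) •
        regularRep q P hP (x.1 : QuantumTorus q P) (Finsupp.single (l - x.2.toAdd) 1) := by
      rw [hc, smul_smul, Units.inv_mul, one_smul]
    rw [h, map_smul, ← Module.End.mul_apply, ← map_mul, Prod.fst_inv, Units.inv_mul, map_one,
      Module.End.one_apply, Prod.snd_inv, toAdd_inv, sub_eq_add_neg]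

lemma gen_mem_translations (hP : P.transpose = -P) (v : ι) :
    (gen q P v, Multiplicative.ofAdd (Pi.single v (1 : ℤ))) ∈ translations q P hP := fun l =>
  ⟨_, by rw [regularRep_gen, genAct_single]; rfl⟩

end Representation

/-! ### The Weyl normalized monomials -/

section Weyl

variable [Fintype ι]

variable (ι) in
/-- The enumeration of the index set which is used in the definition of the Weyl normalized
monomials. -/
noncomputable def enum : List ι := List.ofFn (Fintype.equivFin ι).symm

lemma sum_map_enum {M : Type*} [AddCommMonoid M] (f : ι → M) :
    ((enum ι).map f).sum = ∑ v, f v := by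
  rw [enum, List.map_ofFn, List.sum_ofFn]
  exact Equiv.sum_comp (Fintype.equivFin ι).symm f

lemma exists_weyl_eq (k : ι → ℤ) :
    ∃ c : Rˣ, weyl q P k = (c : R) •
      (listMonomial q P (enum ι) k : QuantumTorus q P) := by
  refine ⟨_, congrArg (_ • ·) ?_⟩
  rw [listMonomial, enum, List.map_ofFn, ← Units.coeHom_apply, map_list_prod, List.map_ofFn]
  rfl

lemma listMonomial_mem_translations [DecidableEq ι] (hP : P.transpose = -P) (k : ι → ℤ) :
    (listMonomial q P (enum ι) k, Multiplicative.ofAdd k) ∈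
      translations q P hP := by
  set l := enum ι
  have h : (listMonomial q P l k, Multiplicative.ofAdd k) =
      (l.map fun v => ((gen q P v, Multiplicative.ofAdd (Pi.single v (1 : ℤ))) :
        (QuantumTorus q P)ˣ × Multiplicative (ι → ℤ)) ^ k v).prod := by
    apply Prod.ext
    · rw [← MonoidHom.coe_fst, map_list_prod, List.map_map]
      rfl
    · apply Multiplicative.toAdd.injective
      rw [← MonoidHom.coe_snd, map_list_prod, List.map_map, toAdd_list_sum, List.map_map]
      erw [sum_map_enum]
      ext w
      simp [Pi.single_apply]
  rw [h]
  apply Subgroup.list_prod_mem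
  intro x hx
  obtain ⟨v, -, rfl⟩ := List.mem_map.1 hx
  exact zpow_mem (gen_mem_translations q P hP v) _

lemma linearIndependent_weyl (hP : P.transpose = -P) : LinearIndependent R (weyl q P) := by
  classical
  have h : ∀ k, ∃ c : Rˣ,
      regularRep q P hP (weyl q P k) (Finsupp.single 0 1) = (c : R) • Finsupp.single k (1 : R) := by
    intro k
    obtain ⟨c, hc⟩ := exists_weyl_eq q P k
    obtain ⟨c', hc'⟩ := listMonomial_mem_translations q P hP k 0
    refine ⟨c * c', ?_⟩
    rw [hc, map_smul, LinearMap.smul_apply, hc', smul_smul]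
    simp
  choose c hc using h
  apply LinearIndependent.of_comp
    ((LinearMap.applyₗ (Finsupp.single 0 (1 : R))).comp (regularRep q P hP).toLinearMap)
  have h1 : LinearIndependent R fun k : ι → ℤ => Finsupp.single k (1 : R) :=
    Finsupp.basisSingleOne.linearIndependent
  convert h1.units_smul c using 1
  ext1 k
  exact hc k

lemma span_weyl : Submodule.span R (Set.range (weyl q P)) = ⊤ := by
  classical
  set l := enum ι
  have hnd : l.Nodup := List.nodup_ofFn.2 (Equiv.injective _)
  have hmem : ∀ v, v ∈ l := fun v => List.mem_ofFn.2 ((Equiv.surjective _) v)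
  set U := Submodule.span R (Set.range (weyl q P))
  have hm : ∀ k, (listMonomial q P l k : QuantumTorus q P) ∈ U := by
    intro k
    obtain ⟨c, hc⟩ := exists_weyl_eq q P k
    have : (listMonomial q P l k : QuantumTorus q P) = ((c⁻¹ : Rˣ) : R) • weyl q P k := by
      rw [hc, smul_smul, Units.inv_mul, one_smul]
    rw [this]
    exact U.smul_mem _ (Submodule.subset_span ⟨k, rfl⟩)
  have h1 : (1 : QuantumTorus q P) ∈ U := by
    have := hm 0
    simpa [listMonomial] using this
  have hmul : ∀ x y, x ∈ U → y ∈ U → x * y ∈ U := by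
    intro x y hx hy
    induction hx, hy using Submodule.span_induction₂ with
    | mem_mem x y hx hy =>
      obtain ⟨k, rfl⟩ := hx
      obtain ⟨k', rfl⟩ := hy
      obtain ⟨c, hc⟩ := exists_weyl_eq q P k
      obtain ⟨c', hc'⟩ := exists_weyl_eq q P k'
      obtain ⟨d, hd⟩ := listMonomial_add q P l k k'
      rw [hc, hc', smul_mul_smul_comm, ← Units.val_mul, ← Units.val_mul, hd, coe_scalar_mul]
      exact U.smul_mem _ (U.smul_mem _ (hm _))
    | zero_left y hy => simp
    | zero_right x hx => simp
    | add_left x y z _ _ _ h1 h2 => rw [add_mul]; exact U.add_mem h1 h2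
    | add_right x y z _ _ _ h1 h2 => rw [mul_add]; exact U.add_mem h1 h2
    | smul_left r x y _ _ h => rw [smul_mul_assoc]; exact U.smul_mem _ h
    | smul_right r x y _ _ h => rw [mul_smul_comm]; exact U.smul_mem _ h
  have := subalgebra_eq_top q P (U.toSubalgebra h1 hmul)
    (fun v => by simpa [listMonomial_single q P l hnd v (hmem v)] using hm (Pi.single v 1))
    (fun v => by simpa [listMonomial_single q P l hnd v (hmem v)] using hm (Pi.single v (-1)))
  simpa using congrArg Subalgebra.toSubmodule this

lemma gen_mul_weyl (v : ι) (k : ι → ℤ) :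
    gen q P v * weyl q P k =
      ((q ^ (2 * P.mulVec k v) : Rˣ) : R) • (weyl q P k * gen q P v) := by
  obtain ⟨c, hc⟩ := exists_weyl_eq q P k
  set l := enum ι
  have hs : (l.map fun u => k u * P v u).sum = P.mulVec k v := by
    rw [sum_map_enum]
    simp [Matrix.mulVec, dotProduct, mul_comm]
  have h : gen q P v * listMonomial q P l k =
      scalar q P (q ^ (2 * P.mulVec k v)) * (listMonomial q P l k * gen q P v) := by
    have := conj_listMonomial q P v l k
    rw [MulAut.conj_apply, hs, mul_inv_eq_iff_eq_mul, mul_assoc] at this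
    exact this
  rw [hc, mul_smul_comm, smul_mul_assoc, smul_comm, ← Units.val_mul, h, coe_scalar_mul,
    Units.val_mul]

/-- The center of the quantum torus of an antisymmetric matrix is spanned by the Weyl normalized
monomials which commute with all generators. -/
theorem center_eq_span [IsDomain R] (hP : P.transpose = -P) :
    Subalgebra.toSubmodule (Subalgebra.center R (QuantumTorus q P)) =
      Submodule.span R (weyl q P '' {k | ∀ v, q ^ (2 * P.mulVec k v) = 1}) := by
  apply le_antisymm
  · intro x hx
    have hx' : x ∈ Submodule.span R (Set.range (weyl q P)) := by rw [span_weyl]; trivial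
    obtain ⟨c, rfl⟩ := (Finsupp.mem_span_range_iff_exists_finsupp).1 hx'
    apply Submodule.sum_mem
    intro k hk
    apply Submodule.smul_mem
    apply Submodule.subset_span
    refine ⟨k, fun v => ?_, rfl⟩
    have h1 : ((gen q P v : QuantumTorus q P)) * (c.sum fun k r => r • weyl q P k) =
        (c.sum fun k r => r • weyl q P k) * gen q P v :=
      (Subalgebra.mem_center_iff (R := R).1 hx _)
    have h2 : (c.sum fun k r =>
        (r * ((q ^ (2 * P.mulVec k v) : Rˣ) - 1 : R)) • weyl q P k) = 0 := by
      apply (gen q P v).isUnit.mul_left_injective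
      simp only [zero_mul]
      rw [← sub_eq_zero] at h1
      rw [← h1]
      simp only [Finsupp.sum, Finset.mul_sum, Finset.sum_mul, ← Finset.sum_sub_distrib]
      refine Finset.sum_congr rfl fun k _ => ?_
      rw [mul_smul_comm, gen_mul_weyl, smul_mul_assoc, smul_mul_assoc, mul_sub, mul_one,
        ← mul_smul, ← sub_smul]
    have h3 := linearIndependent_iff'.1 (linearIndependent_weyl q P hP) c.support _ h2 k hk
    have h4 : ((q ^ (2 * P.mulVec k v) : Rˣ) : R) - 1 = 0 :=
      (mul_eq_zero.1 h3).resolve_left (Finsupp.mem_support_iff.1 hk)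
    exact Units.ext (by simpa using sub_eq_zero.1 h4)
  · rw [Submodule.span_le]
    rintro _ ⟨k, hk, rfl⟩
    have hg : ∀ v, Commute (gen q P v : QuantumTorus q P) (weyl q P k) := by
      intro v
      have := gen_mul_weyl q P v k
      rw [hk v, Units.val_one, one_smul] at this
      exact this
    have htop := subalgebra_eq_top q P (Subalgebra.centralizer R {weyl q P k})
      (fun v => by
        rw [Subalgebra.mem_centralizer_iff]
        rintro _ rfl
        exact (hg v).symm)
      (fun v => by
        rw [Subalgebra.mem_centralizer_iff]
        rintro _ rfl
        exact (hg v).symm.units_inv_right)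
    rw [SetLike.mem_coe, Subalgebra.mem_toSubmodule, Subalgebra.mem_center_iff]
    intro b
    have hb : b ∈ Subalgebra.centralizer R {weyl q P k} := by rw [htop]; trivial
    rw [Subalgebra.mem_centralizer_iff] at hb
    exact (hb _ rfl).symm

end Weyl

end QuantumTorus

/-! ### The matrices of one triangle -/

namespace SmallVertex

variable {n : ℕ}

lemma sum_zmod_three {M : Type*} [AddCommMonoid M] (f : ZMod 3 → M) :
    ∑ a, f a = f 0 + f 1 + f 2 := Fin.sum_univ_three f

lemma zmod_three_cases (a : ZMod 3) : a = 0 ∨ a = 1 ∨ a = 2 := by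
  revert a; decide

lemma coord_nonneg (v : SmallVertex n) (a : ZMod 3) : 0 ≤ v.coord a := Int.natCast_nonneg _

lemma coord_lt (v : SmallVertex n) (a : ZMod 3) : v.coord a < n :=
  Int.ofNat_lt.2 (v.1 a).2

lemma sum_coord (v : SmallVertex n) : v.coord 0 + v.coord 1 + v.coord 2 = n := by
  have h := v.2
  rw [sum_zmod_three] at h
  unfold coord
  exact_mod_cast h

lemma sum_coord_from (v : SmallVertex n) (a : ZMod 3) :
    v.coord a + v.coord (a + 1) + v.coord (a + 2) = n := by
  have h := v.sum_coord
  have e1 : (1 : ZMod 3) + 1 = 2 := by decide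
  have e2 : (1 : ZMod 3) + 2 = 0 := by decide
  have e3 : (2 : ZMod 3) + 1 = 0 := by decide
  have e4 : (2 : ZMod 3) + 2 = 1 := by decide
  rcases zmod_three_cases a with rfl | rfl | rfl <;> simp only [zero_add, e1, e2, e3, e4] <;> omega

lemma ext_coord {v w : SmallVertex n} (h : ∀ a, v.coord a = w.coord a) : v = w :=
  Subtype.ext (funext fun a => Fin.ext (Int.ofNat_inj.1 (h a)))

lemma coord_onSide_self (a : ZMod 3) (i : ℕ) (h0 : 0 < i) (hi : i < n) :
    (onSide a i h0 hi).coord a = i := by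
  simp [coord, onSide]

lemma coord_onSide_add_one (a : ZMod 3) (i : ℕ) (h0 : 0 < i) (hi : i < n) :
    (onSide a i h0 hi).coord (a + 1) = n - i := by
  have : a + 1 ≠ a := by revert a; decide
  simp [coord, onSide, this]
  omega

lemma coord_onSide_add_two (a : ZMod 3) (i : ℕ) (h0 : 0 < i) (hi : i < n) :
    (onSide a i h0 hi).coord (a + 2) = 0 := by
  have h1 : a + 2 ≠ a := by revert a; decide
  have h2 : a + 2 ≠ a + 1 := by revert a; decide
  simp [coord, onSide, h1, h2]

lemma zmod_three_cases_from (a b : ZMod 3) : b = a ∨ b = a + 1 ∨ b = a + 2 := by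
  revert a b; decide

lemma onSide_inj {a b : ZMod 3} {i j : ℕ} {h0 : 0 < i} {hi : i < n} {h0' : 0 < j} {hj : j < n}
    (h : onSide a i h0 hi = onSide b j h0' hj) : a = b ∧ i = j := by
  have c0 := coord_onSide_self a i h0 hi
  have c1 := coord_onSide_add_one a i h0 hi
  have hab : a = b := by
    have c2 := coord_onSide_add_two b j h0' hj
    rw [h] at c0 c1
    have e1 : b + 1 + 1 = b + 2 := by ring
    rcases zmod_three_cases_from b a with rfl | rfl | rfl
    · rfl
    · rw [e1] at c1; omega
    · omega
  subst hab
  refine ⟨rfl, ?_⟩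
  have := coord_onSide_self a j h0' hj
  rw [h] at c0
  omega

/-- A small vertex with a vanishing coordinate lies on the corresponding side. -/
lemma eq_onSide {v : SmallVertex n} {a : ZMod 3} (h : v.coord (a + 2) = 0) :
    ∃ (i : ℕ) (h0 : 0 < i) (hi : i < n), v = onSide a i h0 hi := by
  have h1 := v.sum_coord_from a
  have h2 := v.coord_lt (a + 1)
  have h3 : v.coord a = (v.1 a : ℕ) := rfl
  refine ⟨v.1 a, by omega, (v.1 a).2, ext_coord fun b => ?_⟩
  rcases zmod_three_cases_from a b with rfl | rfl | rfl
  · rw [coord_onSide_self, h3]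
  · rw [coord_onSide_add_one]; omega
  · rw [coord_onSide_add_two, h]

/-! ### The matrix `K` of a triangle as a piecewise linear function -/

/-- The extension of `K s` to all integral points: a linear form plus `n` times a concave piecewise
linear function which is broken along three rays issuing from `s`. -/
def extK (s : SmallVertex n) (p : ZMod 3 → ℤ) : ℤ :=
  s.coord 1 * p 2 + s.coord 2 * p 0 + p 0 * s.coord 1 +
    n * min 0 (min (p 1 - s.coord 1) (s.coord 0 - p 0))

lemma K_eq_extK (s y : SmallVertex n) : K s y = extK s y.coord := by
  have hs := s.sum_coord
  have hy := y.sum_coord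
  have e1 : (1 : ZMod 3) + 1 = 2 := by decide
  have e2 : (1 : ZMod 3) + 2 = 0 := by decide
  have e3 : (2 : ZMod 3) + 1 = 0 := by decide
  have e4 : (2 : ZMod 3) + 2 = 1 := by decide
  unfold K extK
  simp only [kForm, zero_add, e1, e2, e3, e4]
  split_ifs with h0 h1
  · rw [min_eq_left (le_min (by omega) (by omega))]
    ring
  · rw [min_eq_left (a := y.coord 1 - s.coord 1) (by omega), min_eq_right (by omega), ← hs]
    have h2 : y.coord 2 = s.coord 0 + s.coord 1 + s.coord 2 - y.coord 0 - y.coord 1 := by omega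
    rw [h2]; ring
  · rw [min_eq_right (a := y.coord 1 - s.coord 1) (by omega), min_eq_right (by omega), ← hs]
    have h2 : y.coord 2 = s.coord 0 + s.coord 1 + s.coord 2 - y.coord 0 - y.coord 1 := by omega
    rw [h2]; ring

/-- The entries `n min(w,p) - w p` of `n` times the inverse of the Cartan matrix of type
`A_{n-1}`. -/
def kappa (n : ℕ) (w p : ℤ) : ℤ := n * min w p - w * p

lemma kappa_zero_left (n : ℕ) {p : ℤ} (hp : 0 ≤ p) : kappa n 0 p = 0 := by
  simp [kappa, hp]

lemma kappa_sub_sub (n : ℕ) (w p : ℤ) : kappa n (n - w) (n - p) = kappa n w p := by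
  have : min ((n : ℤ) - w) (n - p) = n - w - p + min w p := by omega
  rw [kappa, this, kappa]; ring

/-- Along a side, `K s` only depends on one coordinate of `s`. -/
lemma K_onSide (s : SmallVertex n) (a : ZMod 3) (p : ℕ) (h0 : 0 < p) (hp : p < n) :
    K s (onSide a p h0 hp) = kappa n (s.coord a) p := by
  have c0 := coord_onSide_self a p h0 hp
  have c1 := coord_onSide_add_one a p h0 hp
  have c2 := coord_onSide_add_two a p h0 hp
  have hs := s.sum_coord
  have n0 := s.coord_nonneg 0
  have n1 := s.coord_nonneg 1
  have n2 := s.coord_nonneg 2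
  have e1 : (1 : ZMod 3) + 1 = 2 := by decide
  have e2 : (1 : ZMod 3) + 2 = 0 := by decide
  have e3 : (2 : ZMod 3) + 1 = 0 := by decide
  have e4 : (2 : ZMod 3) + 2 = 1 := by decide
  rw [K_eq_extK]
  unfold extK kappa
  rcases zmod_three_cases a with rfl | rfl | rfl <;>
    simp only [zero_add, e1, e2, e3, e4] at c0 c1 c2 <;> rw [c0, c1, c2]
  · have : min 0 (min ((n : ℤ) - p - s.coord 1) (s.coord 0 - p)) = min (s.coord 0) p - p := by omega
    rw [this, ← hs]; ring
  · have : min 0 (min ((p : ℤ) - s.coord 1) (s.coord 0 - 0)) =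
      min (s.coord 1) p - s.coord 1 := by omega
    rw [this]; ring
  · have : min 0 (min ((0 : ℤ) - s.coord 1) (s.coord 0 - (n - p))) =
      min (s.coord 2) p - s.coord 1 - s.coord 2 := by omega
    rw [this]; ring

/-- `extK s` vanishes at the corners. -/
lemma extK_corner (s : SmallVertex n) (p : ZMod 3 → ℤ) (hp : p 0 + p 1 + p 2 = n)
    (h0 : ∀ a, 0 ≤ p a) (a : ZMod 3) (ha : (n : ℤ) ≤ p a) : extK s p = 0 := by
  have hs := s.sum_coord
  have n0 := s.coord_nonneg 0
  have n1 := s.coord_nonneg 1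
  have n2 := s.coord_nonneg 2
  have p0 := h0 0
  have p1 := h0 1
  have p2 := h0 2
  have h : (p 0 = n ∧ p 1 = 0 ∧ p 2 = 0) ∨ (p 0 = 0 ∧ p 1 = n ∧ p 2 = 0) ∨
      (p 0 = 0 ∧ p 1 = 0 ∧ p 2 = n) := by
    rcases zmod_three_cases a with rfl | rfl | rfl <;> omega
  unfold extK
  rcases h with ⟨e0, e1, e2⟩ | ⟨e0, e1, e2⟩ | ⟨e0, e1, e2⟩ <;> rw [e0, e1, e2]
  · have : min 0 (min (0 - s.coord 1) (s.coord 0 - n)) = - s.coord 1 - s.coord 2 := by omega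
    rw [this]; ring
  · have : min 0 (min (n - s.coord 1) (s.coord 0 - 0)) = 0 := by omega
    rw [this]; ring
  · have : min 0 (min (0 - s.coord 1) (s.coord 0 - 0)) = - s.coord 1 := by omega
    rw [this]; ring

/-- Summation of `K s` against the indicator function of a point; a corner of the triangle may be
included, as `extK s` vanishes there. -/
lemma sum_K_single (s : SmallVertex n) (p : ZMod 3 → ℤ) (hp : p 0 + p 1 + p 2 = n) (c : ℤ) :
    ∑ x, K s x * (if x.coord = p then c else 0) = if ∀ a, 0 ≤ p a then c * extK s p else 0 := by
  split_ifs with h0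
  · by_cases hn : ∀ a, p a < n
    · let v : SmallVertex n := ⟨fun a => ⟨(p a).toNat, by have := hn a; have := h0 a; omega⟩, by
        have := h0 0; have := h0 1; have := h0 2
        rw [sum_zmod_three]; simp only; omega⟩
      have hv : v.coord = p := by
        funext a
        exact Int.toNat_of_nonneg (h0 a)
      rw [Finset.sum_eq_single v]
      · rw [if_pos hv, K_eq_extK, hv, mul_comm]
      · intro x _ hx
        rw [if_neg fun h => hx (ext_coord fun a => by rw [h, hv]), mul_zero]
      · simp
    · push Not at hn
      obtain ⟨a, ha⟩ := hn
      rw [extK_corner s p hp h0 a ha, mul_zero]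
      apply Finset.sum_eq_zero
      intro x _
      rw [if_neg, mul_zero]
      rintro rfl
      exact absurd (x.coord_lt a) (not_lt.2 ha)
  · apply Finset.sum_eq_zero
    intro x _
    rw [if_neg, mul_zero]
    rintro rfl
    exact h0 x.coord_nonneg

/-- The direction of the small edges parallel to the side `a`. -/
def dir (a : ZMod 3) : ZMod 3 → ℤ := Pi.single a 1 - Pi.single (a + 1) 1

lemma dir_self (a : ZMod 3) : dir a a = 1 := by revert a; decide

lemma dir_add_one (a : ZMod 3) : dir a (a + 1) = -1 := by revert a; decide

lemma dir_add_two (a : ZMod 3) : dir a (a + 2) = 0 := by revert a; decide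

lemma forall_zmod_three_from {p : ZMod 3 → Prop} (a : ZMod 3) :
    (∀ b, p b) ↔ p a ∧ p (a + 1) ∧ p (a + 2) :=
  ⟨fun h => ⟨h _, h _, h _⟩, fun h b => by
    rcases zmod_three_cases_from a b with rfl | rfl | rfl
    exacts [h.1, h.2.1, h.2.2]⟩

lemma arrowWeight_eq_sum_sub (v w : SmallVertex n) :
    arrowWeight v w = ∑ a : ZMod 3,
      if v.coord = w.coord - dir a then (if w.coord (a + 2) = 0 then 1 else 2) else 0 := by
  unfold arrowWeight
  refine Finset.sum_congr rfl fun a _ => ?_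
  have h : (w.coord a = v.coord a + 1 ∧ w.coord (a + 1) = v.coord (a + 1) - 1 ∧
      w.coord (a + 2) = v.coord (a + 2)) ↔ v.coord = w.coord - dir a := by
    simp only [funext_iff, forall_zmod_three_from a, Pi.sub_apply, dir_self, dir_add_one,
      dir_add_two]
    omega
  by_cases hvw : v.coord = w.coord - dir a
  · rw [if_pos hvw, if_pos (h.2 hvw), (h.2 hvw).2.2]
  · rw [if_neg hvw, if_neg (mt h.1 hvw)]

lemma arrowWeight_eq_sum_add (v w : SmallVertex n) :
    arrowWeight w v = ∑ a : ZMod 3,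
      if v.coord = w.coord + dir a then (if w.coord (a + 2) = 0 then 1 else 2) else 0 := by
  unfold arrowWeight
  refine Finset.sum_congr rfl fun a _ => ?_
  have h : (v.coord a = w.coord a + 1 ∧ v.coord (a + 1) = w.coord (a + 1) - 1 ∧
      v.coord (a + 2) = w.coord (a + 2)) ↔ v.coord = w.coord + dir a := by
    simp only [funext_iff, forall_zmod_three_from a, Pi.add_apply, dir_self, dir_add_one,
      dir_add_two]
    omega
  by_cases hvw : v.coord = w.coord + dir a
  · rw [if_pos hvw, if_pos (h.2 hvw)]
  · rw [if_neg hvw, if_neg (mt h.1 hvw)]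

/-- The second difference of the concave function `(a, b) ↦ min 0 a b`, in the three directions of
the triangular lattice, is concentrated at the origin. -/
lemma hexagon_sum (a b : ℤ) :
    min 0 (min (a + 1) (b + 1)) - min 0 (min (a - 1) (b - 1)) + min 0 (min (a - 1) b) -
      min 0 (min (a + 1) b) + min 0 (min a (b - 1)) - min 0 (min a (b + 1)) =
      -(if a = 0 ∧ b = 0 then 1 else 0) := by
  rcases lt_trichotomy a b with hab | rfl | hab
  · rw [min_eq_left (a := a + 1) (by omega), min_eq_left (a := a - 1) (by omega),
      min_eq_left (a := a - 1) (by omega), min_eq_left (a := a + 1) (by omega),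
      min_eq_left (a := a) (by omega), min_eq_left (a := a) (by omega)]
    split_ifs <;> omega
  · split_ifs <;> omega
  · rw [min_eq_right (a := a + 1) (by omega), min_eq_right (a := a - 1) (by omega),
      min_eq_right (a := a - 1) (by omega), min_eq_right (a := a + 1) (by omega),
      min_eq_right (a := a) (by omega), min_eq_right (a := a) (by omega)]
    split_ifs <;> omega

/-- The analogue of `hexagon_sum` on the side `0`, with the weights of the arrows. -/
lemma half_hexagon_sum_zero {a b : ℤ} (h : b ≤ a) :
    min 0 (min (a + 1) (b + 1)) - min 0 (min (a - 1) (b - 1)) + 2 * min 0 (min (a - 1) b) -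
      2 * min 0 (min a (b + 1)) =
      (if b = 0 then 1 else 0) - 2 * (if a = 0 ∧ b = 0 then 1 else 0) := by
  rw [min_eq_right (a := a + 1) (by omega), min_eq_right (a := a - 1) (b := b - 1) (by omega)]
  rcases h.eq_or_lt with rfl | h
  · split_ifs <;> omega
  · rw [min_eq_right (a := a - 1) (by omega), min_eq_right (a := a) (by omega)]
    split_ifs <;> omega

/-- The analogue of `hexagon_sum` on the side `1`, with the weights of the arrows. -/
lemma half_hexagon_sum_one {a b : ℤ} (h : 0 ≤ b) :
    min 0 (min (a - 1) b) - min 0 (min (a + 1) b) + 2 * min 0 (min a (b - 1)) -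
      2 * min 0 (min (a - 1) (b - 1)) =
      (if a = 0 then 1 else 0) - 2 * (if a = 0 ∧ b = 0 then 1 else 0) := by
  rcases lt_trichotomy a 0 with ha | rfl | ha
  all_goals split_ifs <;> omega

/-- The analogue of `hexagon_sum` on the side `2`, with the weights of the arrows. -/
lemma half_hexagon_sum_two {a b : ℤ} (h : a ≤ 0) :
    min 0 (min a (b - 1)) - min 0 (min a (b + 1)) + 2 * min 0 (min (a + 1) (b + 1)) -
      2 * min 0 (min (a + 1) b) =
      (if a = b then 1 else 0) - 2 * (if a = 0 ∧ b = 0 then 1 else 0) := by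
  rcases lt_trichotomy a b with hab | rfl | hab
  · rw [min_eq_left (a := a) (by omega), min_eq_left (a := a) (by omega),
      min_eq_left (a := a + 1) (by omega), min_eq_left (a := a + 1) (by omega)]
    split_ifs <;> omega
  · split_ifs <;> omega
  · rw [min_eq_right (a := a) (by omega), min_eq_right (a := a) (by omega),
      min_eq_right (a := a + 1) (by omega), min_eq_right (a := a + 1) (by omega)]
    split_ifs <;> omega

/-- The product of the matrices `K` and `Q` of a triangle. The linear part of `extK s` does not
contribute, because the arrows at a small vertex are balanced; its piecewise linear part contributes
at `s`, and where the legs of `s` reach the boundary of the triangle. -/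
lemma sum_K_mul_Q (s y : SmallVertex n) :
    ∑ x, K s x * Q x y =
      n * ((∑ a, if y.coord (a + 2) = 0 ∧ y.coord a = s.coord a then 1 else 0) -
        2 * (if s = y then 1 else 0)) := by
  have h : ∑ x, K s x * Q x y = ∑ a : ZMod 3,
      ((if ∀ b, 0 ≤ (y.coord - dir a) b then
          (if y.coord (a + 2) = 0 then 1 else 2) * extK s (y.coord - dir a) else 0) -
        (if ∀ b, 0 ≤ (y.coord + dir a) b then
          (if y.coord (a + 2) = 0 then 1 else 2) * extK s (y.coord + dir a) else 0)) := by
    have hd : ∀ a : ZMod 3, dir a 0 + dir a 1 + dir a 2 = 0 := by decide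
    have hy := y.sum_coord
    simp only [Q, mul_sub, Finset.sum_sub_distrib, arrowWeight_eq_sum_sub _ y,
      arrowWeight_eq_sum_add _ y, Finset.mul_sum]
    rw [Finset.sum_comm, Finset.sum_comm (s := Finset.univ (α := SmallVertex n))]
    congr 1 <;> refine Finset.sum_congr rfl fun a _ => ?_
    · rw [sum_K_single]
      have := hd a
      simp only [Pi.sub_apply]
      omega
    · rw [sum_K_single]
      have := hd a
      simp only [Pi.add_apply]
      omega
  have hsy : s = y ↔ s.coord 0 = y.coord 0 ∧ s.coord 1 = y.coord 1 ∧ s.coord 2 = y.coord 2 :=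
    ⟨fun h => by subst h; simp, fun h => ext_coord (forall_zmod_three_from 0 |>.2 h)⟩
  rw [h]
  simp only [hsy]
  have e2 : (1 : ZMod 3) + 2 = 0 := by decide
  have e4 : (2 : ZMod 3) + 2 = 1 := by decide
  have d00 : dir 0 0 = 1 := by decide
  have d01 : dir 0 1 = -1 := by decide
  have d02 : dir 0 2 = 0 := by decide
  have d10 : dir 1 0 = 0 := by decide
  have d11 : dir 1 1 = 1 := by decide
  have d12 : dir 1 2 = -1 := by decide
  have d20 : dir 2 0 = -1 := by decide
  have d21 : dir 2 1 = 0 := by decide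
  have d22 : dir 2 2 = 1 := by decide
  simp only [sum_zmod_three, forall_zmod_three_from 0, extK, Pi.sub_apply, Pi.add_apply, zero_add,
    e2, e4, d00, d01, d02, d10, d11, d12, d20, d21, d22]
  have hs := s.sum_coord
  have hy := y.sum_coord
  have s0 := s.coord_nonneg 0
  have s1 := s.coord_nonneg 1
  have s2 := s.coord_nonneg 2
  have y0 := y.coord_nonneg 0
  have y1 := y.coord_nonneg 1
  have y2 := y.coord_nonneg 2
  have l0 := y.coord_lt 0
  have l1 := y.coord_lt 1
  have l2 := y.coord_lt 2
  generalize s.coord 0 = i at *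
  generalize s.coord 1 = j at *
  generalize s.coord 2 = k at *
  generalize y.coord 0 = i' at *
  generalize y.coord 1 = j' at *
  generalize y.coord 2 = k' at *
  simp only [sub_zero, add_zero, sub_neg_eq_add, ← sub_eq_add_neg]
  have c1 : (0 ≤ i' - 1 ∧ 0 ≤ j' + 1 ∧ 0 ≤ k') ↔ i' ≠ 0 := by omega
  have c2 : (0 ≤ i' + 1 ∧ 0 ≤ j' - 1 ∧ 0 ≤ k') ↔ j' ≠ 0 := by omega
  have c3 : (0 ≤ i' ∧ 0 ≤ j' - 1 ∧ 0 ≤ k' + 1) ↔ j' ≠ 0 := by omega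
  have c4 : (0 ≤ i' ∧ 0 ≤ j' + 1 ∧ 0 ≤ k' - 1) ↔ k' ≠ 0 := by omega
  have c5 : (0 ≤ i' + 1 ∧ 0 ≤ j' ∧ 0 ≤ k' - 1) ↔ k' ≠ 0 := by omega
  have c6 : (0 ≤ i' - 1 ∧ 0 ≤ j' ∧ 0 ≤ k' + 1) ↔ i' ≠ 0 := by omega
  simp only [c1, c2, c3, c4, c5, c6]
  rw [show j' + 1 - j = j' - j + 1 by ring, show j' - 1 - j = j' - j - 1 by ring,
    show i - (i' - 1) = i - i' + 1 by ring, show i - (i' + 1) = i - i' - 1 by ring]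
  have hz : (i = i' ∧ j = j' ∧ k = k') ↔ (j' - j = 0 ∧ i - i' = 0) := by omega
  simp only [hz]
  by_cases hk : k' = 0
  · have hi : i' ≠ 0 := by omega
    have hj : j' ≠ 0 := by omega
    have hm := half_hexagon_sum_zero (a := j' - j) (b := i - i') (by omega)
    have hz' : i' = i ↔ i - i' = 0 := by omega
    simp only [hk, hi, hj, hz', ne_eq, not_true_eq_false, not_false_eq_true, if_true, if_false,
      true_and, false_and] at hm ⊢
    linear_combination (n : ℤ) * hm
  by_cases hi : i' = 0
  · have hj : j' ≠ 0 := by omega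
    have hm := half_hexagon_sum_one (a := j' - j) (b := i - i') (by omega)
    have hz' : j' = j ↔ j' - j = 0 := by omega
    simp only [hk, hi, hj, hz', ne_eq, not_true_eq_false, not_false_eq_true, if_true, if_false,
      true_and, false_and] at hm ⊢
    linear_combination (n : ℤ) * hm
  by_cases hj : j' = 0
  · have hm := half_hexagon_sum_two (a := j' - j) (b := i - i') (by omega)
    have hz' : k' = k ↔ j' - j = i - i' := by omega
    simp only [hk, hi, hj, hz', ne_eq, not_true_eq_false, not_false_eq_true, if_true, if_false,
      true_and, false_and] at hm ⊢
    linear_combination (n : ℤ) * hm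
  · have hm := hexagon_sum (j' - j) (i - i')
    simp only [hk, hi, hj, ne_eq, not_false_eq_true, if_true, if_false, false_and] at hm ⊢
    linear_combination 2 * (n : ℤ) * hm

end SmallVertex

/-! ### Paths turning left -/

namespace IdealTriangulation

variable {F : Type*} (T : IdealTriangulation F)

/-- The path which has left a face through the side `a`, not a boundary edge, leaves the next face
through the side `b`, after a left turn. -/
def NextExit (a b : F × ZMod 3) : Prop := ¬ T.IsBoundary a ∧ b = left (T.glue a)

/-- The path which leaves a face through the side `s`, and then turns left in every face, at some
moment leaves a face through the side `t`, or ends there. -/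
def Exits : F × ZMod 3 → F × ZMod 3 → Prop := Relation.ReflTransGen T.NextExit

variable {T}

lemma leftTurn_iff_exits {s t : F × ZMod 3} : T.LeftTurn s t ↔ T.Exits (left s) t := by
  constructor
  · intro h
    induction h with
    | start => exact .refl
    | step t _ ht ih => exact ih.tail ⟨ht, rfl⟩
  · intro h
    induction h with
    | refl => exact .start s
    | tail _ h ih =>
      obtain ⟨h, rfl⟩ := h
      exact .step _ _ ih h

lemma isBoundary_glue {s : F × ZMod 3} : T.IsBoundary (T.glue s) ↔ T.IsBoundary s := by
  unfold IsBoundary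
  rw [T.glue_glue]
  exact eq_comm

lemma left_injective : Function.Injective (left : F × ZMod 3 → F × ZMod 3) := by
  rintro ⟨f, a⟩ ⟨g, b⟩ h
  simpa [left] using h

lemma exits_iff_of_isBoundary {s t : F × ZMod 3} (hs : T.IsBoundary s) :
    T.Exits s t ↔ t = s := by
  constructor
  · intro h
    rcases h.cases_head with h | ⟨b, h, -⟩
    · exact h.symm
    · exact absurd hs h.1
  · rintro rfl
    exact .refl

lemma nextExit_rightUnique : Relator.RightUnique T.NextExit := by
  rintro a b c ⟨-, rfl⟩ ⟨-, rfl⟩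
  rfl

lemma Exits.eq_of_isBoundary {s t t' : F × ZMod 3} (h : T.Exits s t) (h' : T.Exits s t')
    (ht : T.IsBoundary t) (ht' : T.IsBoundary t') : t = t' := by
  rcases Relation.ReflTransGen.total_of_right_unique nextExit_rightUnique h h' with h | h
  · exact ((exits_iff_of_isBoundary ht).1 h).symm
  · exact (exits_iff_of_isBoundary ht').1 h

lemma LeftTurn.eq_of_isBoundary {s t t' : F × ZMod 3} (h : T.LeftTurn s t) (h' : T.LeftTurn s t')
    (ht : T.IsBoundary t) (ht' : T.IsBoundary t') : t = t' :=
  (leftTurn_iff_exits.1 h).eq_of_isBoundary (leftTurn_iff_exits.1 h') ht ht'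

/-- A path which turns left can be followed backwards up to the boundary. -/
lemma LeftTurn.source_eq {s s' t : F × ZMod 3} (h : T.LeftTurn s t) (h' : T.LeftTurn s' t)
    (hs : T.IsBoundary s) (hs' : T.IsBoundary s') : s = s' := by
  induction h with
  | start =>
    generalize hr : left s = r at h'
    cases h' with
    | start => exact left_injective hr
    | step t _ ht =>
      rw [left_injective hr, isBoundary_glue] at hs
      exact absurd hs ht
  | step t _ ht ih =>
    generalize hr : left (T.glue t) = r at h'
    cases h' with
    | start =>
      rw [← left_injective hr, isBoundary_glue] at hs'
      exact absurd hs' ht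
    | step t' h' ht' =>
      have : t = t' := by
        have := congrArg T.glue (left_injective hr)
        rwa [T.glue_glue, T.glue_glue] at this
      subst this
      exact ih h'

/-- The side through which a path turning left has entered a face, if it leaves it through `t`. -/
def right (t : F × ZMod 3) : F × ZMod 3 := (t.1, t.2 + 2)

lemma left_right (t : F × ZMod 3) : left (right t) = t := by
  have : ∀ a : ZMod 3, a + 2 + 1 = a := by decide
  simp [left, right, this]

lemma right_left (t : F × ZMod 3) : right (left t) = t := by
  have : ∀ a : ZMod 3, a + 1 + 2 = a := by decide
  simp [left, right, this]

/-- Without interior punctures, a path which turns left in every face does not close up. -/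
lemma NoInteriorPuncture.not_transGen_self (h : T.NoInteriorPuncture) (s : F × ZMod 3) :
    ¬ Relation.TransGen T.NextExit s s := by
  intro hs
  obtain ⟨t, hst, ht⟩ := h (right s)
  rw [leftTurn_iff_exits, left_right] at hst
  -- the path is deterministic, so periodicity propagates along the path, up to its end on the boundary
  have hloop : Relation.TransGen T.NextExit t t := by
    clear ht
    induction hst with
    | refl => exact hs
    | @tail b c _ hbc ih =>
      obtain ⟨b', hb', hb⟩ := Relation.TransGen.head'_iff.1 ih
      rw [nextExit_rightUnique hb' hbc] at hb
      exact Relation.TransGen.tail' hb hbc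
  obtain ⟨b, hb, -⟩ := Relation.TransGen.head'_iff.1 hloop
  exact hb.1 ht

lemma enters_iff {s t : F × ZMod 3} :
    T.Enters s t ↔ ¬ T.IsBoundary t ∧ T.Exits s (T.glue t) := by
  constructor
  · rintro (⟨hs, rfl⟩ | ⟨hs, t', h, ht', rfl⟩)
    · rw [isBoundary_glue, T.glue_glue]
      exact ⟨hs, .refl⟩
    · rw [isBoundary_glue, T.glue_glue]
      exact ⟨ht', (leftTurn_iff_exits.1 h).head ⟨hs, rfl⟩⟩
  · rintro ⟨ht, h⟩
    rcases h.cases_head with rfl | ⟨b, ⟨hs, rfl⟩, h⟩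
    · left
      rw [isBoundary_glue, T.glue_glue]
      exact ⟨ht, rfl⟩
    · right
      exact ⟨hs, T.glue t, leftTurn_iff_exits.2 h, by rwa [isBoundary_glue], (T.glue_glue t).symm⟩

lemma enters_glue_iff {s t : F × ZMod 3} (ht : ¬ T.IsBoundary t) :
    T.Enters s (T.glue t) ↔ T.Exits s t := by
  rw [enters_iff, isBoundary_glue, T.glue_glue]
  exact and_iff_right ht

lemma exits_glue_iff {s t : F × ZMod 3} (ht : ¬ T.IsBoundary t) :
    T.Exits s (T.glue t) ↔ T.Enters s t := by
  rw [enters_iff]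
  exact (and_iff_right ht).symm

lemma exits_iff_eq_or_enters {s t : F × ZMod 3} :
    T.Exits s t ↔ t = s ∨ T.Enters s (right t) := by
  constructor
  · intro h
    rcases h.cases_tail with h | ⟨b, h, hb, rfl⟩
    · exact .inl h
    · right
      rwa [right_left, enters_glue_iff hb]
  · rintro (rfl | h)
    · exact .refl
    · obtain ⟨h1, h2⟩ := enters_iff.1 h
      refine Relation.ReflTransGen.tail h2 ⟨by rwa [isBoundary_glue], ?_⟩
      rw [T.glue_glue, left_right]

lemma NoInteriorPuncture.not_enters_right (h : T.NoInteriorPuncture) (s : F × ZMod 3) :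
    ¬ T.Enters s (right s) := by
  intro hs
  obtain ⟨h1, h2⟩ := enters_iff.1 hs
  refine h.not_transGen_self s (Relation.TransGen.tail' h2 ⟨by rwa [isBoundary_glue], ?_⟩)
  rw [T.glue_glue, left_right]

open Classical in
/-- The number of exits through a side, counted by the entries before the left turns. -/
lemma NoInteriorPuncture.ite_exits (h : T.NoInteriorPuncture) (s t : F × ZMod 3) (c : ℤ) :
    (if T.Exits s t then c else 0) =
      (if t = s then c else 0) + (if T.Enters s (right t) then c else 0) := by
  rw [if_congr exits_iff_eq_or_enters rfl rfl]
  by_cases hts : t = s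
  · subst hts
    simp [h.not_enters_right t]
  · simp [hts]

open SmallVertex

variable {n : ℕ}

lemma sum_zmod_three_from {M : Type*} [AddCommMonoid M] (b : ZMod 3) (f : ZMod 3 → M) :
    ∑ a, f a = f b + f (b + 1) + f (b + 2) := by
  rw [← Equiv.sum_comp (Equiv.addLeft b) f, sum_zmod_three]
  simp

/-! ### Evaluation on skeletons -/

open Classical in
lemma skeleton_sum (x : F × SmallVertex n) (τ : F) (f : SmallVertex n → ℤ) :
    ((T.skeleton x τ).sum fun y m => m * f y) =
      (if x.1 = τ then f x.2 else 0) + ∑ a : ZMod 3, ∑ b : ZMod 3,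
        if h : 0 < (x.2.1 a : ℕ) then
          if T.Enters (x.1, a) (τ, b) then
            f (onSide b (n - (x.2.1 a : ℕ)) (Nat.sub_pos_of_lt (x.2.1 a).2)
              (Nat.sub_lt ((Nat.zero_le _).trans_lt (x.2.1 a).2) h))
          else 0
        else 0 := by
  let φ : (SmallVertex n →₀ ℤ) →+ ℤ := Finsupp.liftAddHom fun y => AddMonoidHom.mulRight (f y)
  have hφ : ∀ y, φ (Finsupp.single y 1) = f y := fun y => by simp [φ]
  change φ (T.skeleton x τ) = _
  unfold skeleton
  rw [map_add, map_sum]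
  congr 1
  · split_ifs
    · exact hφ _
    · exact map_zero φ
  · refine Finset.sum_congr rfl fun a _ => ?_
    rw [map_sum]
    refine Finset.sum_congr rfl fun b _ => ?_
    split_ifs
    · exact hφ _
    · exact map_zero φ
    · exact map_zero φ

open Classical in
/-- If a function of small vertices depends only on the distance from the side `t`, its sum over a
skeleton counts the legs which leave or enter through `t`. -/
lemma skeleton_sum_coord (hT : T.NoInteriorPuncture) (x : F × SmallVertex n) (t : F × ZMod 3)
    (φ : ℤ → ℤ) (h0 : φ 0 = 0) :
    ((T.skeleton x t.1).sum fun y m => m * φ (y.coord t.2)) =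
      ∑ a, ((if T.Exits (x.1, a) t then φ (x.2.coord a) else 0) +
        (if 0 < x.2.coord a ∧ T.Enters (x.1, a) t then φ (n - x.2.coord a) else 0)) := by
  rw [skeleton_sum]
  have h1 : (if x.1 = t.1 then φ (x.2.coord t.2) else 0) =
      ∑ a, if t = (x.1, a) then φ (x.2.coord a) else 0 := by
    by_cases hx : x.1 = t.1
    · rw [if_pos hx, Finset.sum_eq_single t.2]
      · exact (if_pos (Prod.ext hx.symm rfl : t = (x.1, t.2))).symm
      · intro a _ ha
        rw [if_neg]
        rintro rfl
        exact ha rfl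
      · simp
    · rw [if_neg hx, Finset.sum_eq_zero]
      intro a _
      rw [if_neg]
      rintro rfl
      exact hx rfl
  rw [h1, ← Finset.sum_add_distrib]
  refine Finset.sum_congr rfl fun a _ => ?_
  rw [hT.ite_exits, add_assoc]
  congr 1
  have hx : x.2.coord a = ((x.2.1 a : ℕ) : ℤ) := rfl
  have hlt := (x.2.1 a).2
  by_cases hpos : 0 < (x.2.1 a : ℕ)
  · have hpos' : 0 < x.2.coord a := by omega
    simp only [hpos, hpos', dif_pos, true_and]
    have c0 := fun b h h' => coord_onSide_self (n := n) b (n - (x.2.1 a : ℕ)) h h'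
    have e1 : t.2 + 2 + 1 = t.2 := by generalize t.2 = b; revert b; decide
    have e2 : t.2 + 1 + 2 = t.2 := by generalize t.2 = b; revert b; decide
    have c1 := fun h h' => coord_onSide_add_one (n := n) (t.2 + 2) (n - (x.2.1 a : ℕ)) h h'
    have c2 := fun h h' => coord_onSide_add_two (n := n) (t.2 + 1) (n - (x.2.1 a : ℕ)) h h'
    rw [e1] at c1
    rw [e2] at c2
    rw [sum_zmod_three_from t.2]
    simp only [c0, c1, c2, h0, ite_self, add_zero]
    rw [Nat.cast_sub hlt.le, ← hx, sub_sub_cancel]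
    exact add_comm _ _
  · have hz : x.2.coord a = 0 := by omega
    simp [hpos, hz, h0]

open Classical in
/-- The number of times a small vertex of the side `t` appears in a skeleton. -/
lemma skeleton_sum_onSide (x : F × SmallVertex n) (t : F × ZMod 3) (p : ℕ) (h0 : 0 < p)
    (hp : p < n) :
    ((T.skeleton x t.1).sum fun y m => m * (if y = onSide t.2 p h0 hp then 1 else 0)) =
      (if x = (t.1, onSide t.2 p h0 hp) then 1 else 0) +
        ∑ a, if T.Enters (x.1, a) t ∧ n - x.2.coord a = p then 1 else 0 := by
  rw [skeleton_sum]
  congr 1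
  · by_cases hx : x.1 = t.1
    · simp [hx, Prod.ext_iff]
    · simp [hx, Prod.ext_iff]
  · refine Finset.sum_congr rfl fun a _ => ?_
    have hx : x.2.coord a = ((x.2.1 a : ℕ) : ℤ) := rfl
    have hlt := (x.2.1 a).2
    rw [Finset.sum_eq_single t.2]
    · by_cases hpos : 0 < (x.2.1 a : ℕ)
      · rw [dif_pos hpos]
        have : onSide t.2 (n - (x.2.1 a : ℕ)) (Nat.sub_pos_of_lt (x.2.1 a).2)
          (Nat.sub_lt ((Nat.zero_le _).trans_lt (x.2.1 a).2) hpos) = onSide t.2 p h0 hp ↔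
            n - x.2.coord a = p := by
          constructor
          · intro h
            have := (onSide_inj h).2
            omega
          · intro h
            congr 1
            omega
        simp only [this, ite_and]
      · rw [dif_neg hpos, if_neg]
        omega
    · intro b _ hb
      split_ifs with h1 h2 h3
      · exact absurd (onSide_inj h3).1 hb
      · rfl
      · rfl
      · rfl
    · simp

/-! ### Small vertices of the surface -/

lemma glueRel_symm {x y : F × SmallVertex n} (h : T.GlueRel n x y) : T.GlueRel n y x := by
  cases h with
  | mk s hs i h0 hi =>
    have := GlueRel.mk (T := T) (n := n) (T.glue s) (by rwa [isBoundary_glue]) (n - i) (by omega)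
      (by omega)
    simpa only [T.glue_glue, Nat.sub_sub_self hi.le] using this

lemma glueRel_onSide {t : F × ZMod 3} {p : ℕ} {h0 : 0 < p} {hp : p < n} {y : F × SmallVertex n} :
    T.GlueRel n (t.1, onSide t.2 p h0 hp) y ↔
      ¬ T.IsBoundary t ∧
        y = ((T.glue t).1, onSide (T.glue t).2 (n - p) (by omega) (by omega)) := by
  constructor
  · intro h
    generalize hx : (t.1, onSide t.2 p h0 hp) = x at h
    cases h with
    | mk s hs i h0 hi =>
      rw [Prod.mk.injEq] at hx
      obtain ⟨h1, h2⟩ := hx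
      obtain ⟨h3, rfl⟩ := onSide_inj h2
      have : t = s := Prod.ext h1 h3
      subst this
      exact ⟨hs, rfl⟩
  · rintro ⟨h, rfl⟩
    exact .mk t h p h0 hp

/-- Each small vertex is identified with at most one other one. -/
lemma mkVertex_eq_iff {x y : F × SmallVertex n} :
    T.mkVertex x = T.mkVertex y ↔ x = y ∨ T.GlueRel n x y := by
  constructor
  · intro h
    replace h : Relation.EqvGen (T.GlueRel n) x y := Quotient.exact h
    induction h with
    | rel x y h => exact .inr h
    | refl x => exact .inl rfl
    | symm x y _ ih =>
      rcases ih with rfl | h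
      · exact .inl rfl
      · exact .inr (glueRel_symm h)
    | trans x y z _ _ h1 h2 =>
      rcases h1 with rfl | h1
      · exact h2
      rcases h2 with rfl | h2
      · exact .inr h1
      left
      cases h1 with
      | mk s hs i h0 hi =>
        rw [glueRel_onSide] at h2
        rw [h2.2]
        simp only [T.glue_glue, Nat.sub_sub_self hi.le]
  · rintro (rfl | h)
    · rfl
    · exact Quotient.sound (.rel _ _ h)

lemma mkVertex_out (u : T.Vertex n) : T.mkVertex u.out = u := Quotient.out_eq u

lemma edgeVertex_eq_iff {s : F × ZMod 3} (hs : T.IsBoundary s) {i : ℕ} {h0 : 0 < i} {hi : i < n}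
    {x : F × SmallVertex n} :
    T.edgeVertex s i h0 hi = T.mkVertex x ↔ x = (s.1, onSide s.2 i h0 hi) := by
  rw [edgeVertex, mkVertex_eq_iff, glueRel_onSide]
  simp [hs, eq_comm]

lemma edgeVertex_out {s : F × ZMod 3} (hs : T.IsBoundary s) {i : ℕ} {h0 : 0 < i} {hi : i < n} :
    (T.edgeVertex s i h0 hi).out = (s.1, onSide s.2 i h0 hi) := by
  rw [← edgeVertex_eq_iff hs, mkVertex_out]

lemma edgeVertex_inj {s t : F × ZMod 3} (hs : T.IsBoundary s) {i j : ℕ} {h0 : 0 < i} {hi : i < n}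
    {h0' : 0 < j} {hj : j < n} (h : T.edgeVertex s i h0 hi = T.edgeVertex t j h0' hj) :
    s = t ∧ i = j := by
  have h1 := (edgeVertex_eq_iff hs).1 h
  rw [Prod.mk.injEq] at h1
  obtain ⟨h2, h3⟩ := h1
  obtain ⟨h4, h5⟩ := onSide_inj h3
  exact ⟨Prod.ext h2.symm h4.symm, h5.symm⟩

/-- The value of `Kbar` does not depend on the choice of the face containing the second vertex. -/
lemma Kbar_mkVertex (hT : T.NoInteriorPuncture) (u : T.Vertex n) (z : F × SmallVertex n) :
    T.Kbar n u (T.mkVertex z) =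
      (T.skeleton u.out z.1).sum fun y m => m * SmallVertex.K y z.2 := by
  classical
  have h := mkVertex_eq_iff.1 (mkVertex_out (T.mkVertex z))
  unfold Kbar
  rcases h with h | h
  · rw [h]
  · generalize (T.mkVertex z).out = w at h
    cases h with
    | mk s hs i h0 hi =>
      simp only [K_onSide]
      rw [skeleton_sum_coord hT u.out s (fun w => kappa n w i) (kappa_zero_left n (by omega)),
        skeleton_sum_coord hT u.out (T.glue s) (fun w => kappa n w ((n - i : ℕ) : ℤ))
          (kappa_zero_left n (by omega))]
      refine Finset.sum_congr rfl fun a _ => ?_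
      simp only [exits_glue_iff hs, enters_glue_iff hs, Nat.cast_sub hi.le]
      have h1 := kappa_sub_sub n (u.out.2.coord a) i
      have h2 := kappa_sub_sub n (u.out.2.coord a) (n - i)
      rw [sub_sub_cancel] at h2
      rw [h1, h2]
      rcases (u.out.2.coord_nonneg a).eq_or_lt with h | h
      · simp only [← h, lt_irrefl, false_and, if_false, add_zero]
        rw [kappa_zero_left n (by omega), kappa_zero_left n (by omega)]
        simp
      · simp only [h, true_and]
        exact add_comm _ _

/-! ### The product of `Kbar` and `Qbar` -/

/-- The number of legs of weight `p` of the skeleton of `u` which end at the boundary edge `t`. -/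
noncomputable def legEnds (u : T.Vertex n) (t : F × ZMod 3) (p : ℤ) : ℤ :=
  open Classical in ∑ a, if T.Exits (u.out.1, a) t ∧ u.out.2.coord a = p then 1 else 0

/-- The pairing of the skeleton of `u` in the face `z.1` with the column `z.2` of `K Q / n`. -/
noncomputable def faceTerm (u : T.Vertex n) (z : F × SmallVertex n) : ℤ :=
  open Classical in (T.skeleton u.out z.1).sum fun y m =>
    m * ((∑ a, if z.2.coord (a + 2) = 0 ∧ z.2.coord a = y.coord a then 1 else 0) -
      2 * (if y = z.2 then 1 else 0))

open Classical in
lemma Kbar_mul_Qbar_apply [Fintype F] (hT : T.NoInteriorPuncture) (u w : T.Vertex n) :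
    (T.Kbar n * T.Qbar n) u w =
      n * ∑ z : F × SmallVertex n, if T.mkVertex z = w then faceTerm u z else 0 := by
  have h1 : ∀ z : F × SmallVertex n,
      ∑ x, T.Kbar n u (T.mkVertex (z.1, x)) * SmallVertex.Q x z.2 = n * faceTerm u z := by
    intro z
    simp only [Kbar_mkVertex hT, faceTerm, Finsupp.sum, Finset.sum_mul]
    rw [Finset.sum_comm, Finset.mul_sum]
    refine Finset.sum_congr rfl fun y _ => ?_
    simp only [mul_assoc]
    rw [← Finset.mul_sum, sum_K_mul_Q]
    ring
  rw [Matrix.mul_apply]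
  simp only [Qbar, Finset.mul_sum]
  rw [Finset.sum_comm, Fintype.sum_prod_type]
  refine Finset.sum_congr rfl fun τ _ => ?_
  have h2 : ∀ v x, ∑ y, T.Kbar n u v * (if T.mkVertex (τ, x) = v ∧ T.mkVertex (τ, y) = w then
      SmallVertex.Q x y else 0) = if T.mkVertex (τ, x) = v then
        ∑ y, (if T.mkVertex (τ, y) = w then T.Kbar n u v * SmallVertex.Q x y else 0) else 0 := by
    intro v x
    split_ifs with h <;> simp [h]
  simp only [h2]
  rw [Finset.sum_comm]
  simp only [Finset.sum_ite_eq, Finset.mem_univ, if_true]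
  rw [Finset.sum_comm]
  refine Finset.sum_congr rfl fun y _ => ?_
  split_ifs
  · exact h1 (τ, y)
  · simp

open Classical in
lemma faceTerm_interior (u : T.Vertex n) (z : F × SmallVertex n) (hz : ∀ a, z.2.coord a ≠ 0) :
    faceTerm u z = -2 * (if u.out = z then 1 else 0) := by
  simp only [faceTerm, hz, false_and, if_false, Finset.sum_const_zero, zero_sub]
  rw [skeleton_sum (f := fun y => -(2 * (if y = z.2 then 1 else 0)))]
  have : ∀ b p h0 hp, onSide b p h0 hp ≠ z.2 := by
    intro b p h0 hp h
    exact hz _ (h ▸ coord_onSide_add_two b p h0 hp)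
  simp only [this, if_false, mul_zero, neg_zero, ite_self, dite_eq_ite, Finset.sum_const_zero,
    add_zero]
  by_cases h : u.out.1 = z.1 <;> by_cases h' : u.out.2 = z.2 <;> simp [h, h', Prod.ext_iff]

open Classical in
lemma faceTerm_onSide (hT : T.NoInteriorPuncture) (u : T.Vertex n) (t : F × ZMod 3) (p : ℕ)
    (h0 : 0 < p) (hp : p < n) :
    faceTerm u (t.1, onSide t.2 p h0 hp) =
      legEnds u t p - (∑ a, if T.Enters (u.out.1, a) t ∧ n - u.out.2.coord a = p then 1 else 0) -
        2 * (if u.out = (t.1, onSide t.2 p h0 hp) then 1 else 0) := by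
  have h1 : ∀ y : SmallVertex n, (∑ a, if (onSide t.2 p h0 hp).coord (a + 2) = 0 ∧
      (onSide t.2 p h0 hp).coord a = y.coord a then (1 : ℤ) else 0) =
        if y.coord t.2 = p then 1 else 0 := by
    intro y
    have e1 : t.2 + 1 + 2 = t.2 := by generalize t.2 = b; revert b; decide
    have e2 : t.2 + 2 + 2 = t.2 + 1 := by generalize t.2 = b; revert b; decide
    have h3 : (p : ℤ) ≠ 0 := by omega
    have h4 : (n : ℤ) - p ≠ 0 := by omega
    rw [sum_zmod_three_from t.2, e1, e2, coord_onSide_self, coord_onSide_add_one,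
      coord_onSide_add_two]
    simp only [h3, h4, true_and, false_and, if_false, add_zero]
    exact if_congr eq_comm rfl rfl
  have h2 := skeleton_sum_coord hT u.out t (fun w => if w = p then 1 else 0)
    (if_neg (by omega))
  have h3 := skeleton_sum_onSide (T := T) u.out t p h0 hp
  simp only [faceTerm, h1]
  have h4 : ((T.skeleton u.out t.1).sum fun y m => m * ((if y.coord t.2 = p then 1 else 0) -
      2 * (if y = onSide t.2 p h0 hp then 1 else 0))) =
      ((T.skeleton u.out t.1).sum fun y m => m * (if y.coord t.2 = p then 1 else 0)) -
      2 * ((T.skeleton u.out t.1).sum fun y m =>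
        m * (if y = onSide t.2 p h0 hp then 1 else 0)) := by
    simp only [Finsupp.sum, Finset.mul_sum, ← Finset.sum_sub_distrib]
    exact Finset.sum_congr rfl fun _ _ => by ring
  rw [h4, h2, h3, legEnds, Finset.sum_add_distrib]
  have h5 : ∀ a, (if 0 < u.out.2.coord a ∧ T.Enters (u.out.1, a) t then
      (if (n : ℤ) - u.out.2.coord a = p then (1 : ℤ) else 0) else 0) =
      if T.Enters (u.out.1, a) t ∧ n - u.out.2.coord a = p then 1 else 0 := by
    intro a
    rw [← ite_and]
    refine if_congr ⟨fun h => ⟨h.1.2, h.2⟩, fun h => ⟨⟨?_, h.1⟩, h.2⟩⟩ rfl rfl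
    omega
  simp only [h5, ← ite_and]
  ring

/-- The function on the small vertices of the surface which takes the values `d t p` at the boundary
vertices and vanishes elsewhere. -/
noncomputable def extendBoundary (d : F × ZMod 3 → ℕ → ℤ) (w : T.Vertex n) : ℤ :=
  open Classical in if h : T.OnBoundary w then d h.choose h.choose_spec.2.choose else 0

lemma extendBoundary_edgeVertex (d : F × ZMod 3 → ℕ → ℤ) {t : F × ZMod 3} (ht : T.IsBoundary t)
    {p : ℕ} (h0 : 0 < p) (hp : p < n) :
    extendBoundary d (T.edgeVertex t p h0 hp) = d t p := by
  have h : T.OnBoundary (T.edgeVertex t p h0 hp) := ⟨t, ht, p, h0, hp, rfl⟩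
  obtain ⟨_, _, h'⟩ := h.choose_spec.2.choose_spec
  obtain ⟨h1, h2⟩ := edgeVertex_inj ht h'
  rw [extendBoundary, dif_pos h]
  have key : ∀ s i, t = s → p = i → d s i = d t p := by
    rintro _ _ rfl rfl
    rfl
  exact key _ _ h1 h2

lemma extendBoundary_of_not_onBoundary (d : F × ZMod 3 → ℕ → ℤ) {w : T.Vertex n}
    (hw : ¬ T.OnBoundary w) : extendBoundary d w = 0 := dif_neg hw

/-- The matrix with entries `S(u, w)`, the number of legs of the skeleton of `u` which end at the
boundary vertex `w`. -/
noncomputable def legMatrix (T : IdealTriangulation F) (n : ℕ) :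
    Matrix (T.Vertex n) (T.Vertex n) ℤ :=
  fun u => extendBoundary fun t p => legEnds u t p

lemma legMatrix_edgeVertex (u : T.Vertex n) {t : F × ZMod 3} (ht : T.IsBoundary t) (p : ℕ)
    (h0 : 0 < p) (hp : p < n) :
    legMatrix T n u (T.edgeVertex t p h0 hp) = legEnds u t p :=
  extendBoundary_edgeVertex _ ht h0 hp

lemma legMatrix_of_not_onBoundary (u : T.Vertex n) {w : T.Vertex n} (hw : ¬ T.OnBoundary w) :
    legMatrix T n u w = 0 := extendBoundary_of_not_onBoundary _ hw

open Classical in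
lemma sum_fiber_pair [Fintype F] {w : T.Vertex n} {z z' : F × SmallVertex n}
    (hzz : z ≠ z') (h : ∀ x, T.mkVertex x = w ↔ x = z ∨ x = z') (g : F × SmallVertex n → ℤ) :
    (∑ x, if T.mkVertex x = w then g x else 0) = g z + g z' := by
  rw [← Finset.sum_filter, ← Finset.sum_pair hzz]
  congr 1
  ext x
  simp [h]

open Classical in
lemma sum_fiber_single [Fintype F] {w : T.Vertex n} {z : F × SmallVertex n}
    (h : ∀ x, T.mkVertex x = w ↔ x = z) (g : F × SmallVertex n → ℤ) :
    (∑ x, if T.mkVertex x = w then g x else 0) = g z := by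
  simp [h]

/-- The product of `Kbar` and `Qbar`. At a small vertex on a glued side, the contributions of the
legs passing through it cancel; only the ends of the legs on the boundary remain. -/
theorem Kbar_mul_Qbar [Fintype F] [DecidableEq (T.Vertex n)] (hT : T.NoInteriorPuncture) :
    T.Kbar n * T.Qbar n = (n : ℤ) • (legMatrix T n - 2) := by
  classical
  ext u w
  rw [Kbar_mul_Qbar_apply hT, Matrix.smul_apply, smul_eq_mul]
  congr 1
  have h2 : (2 : Matrix (T.Vertex n) (T.Vertex n) ℤ) u w = 2 * (if u = w then 1 else 0) := by
    rw [Matrix.ofNat_apply]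
    split_ifs <;> rfl
  rw [Matrix.sub_apply, h2]
  obtain ⟨⟨τ, y⟩, rfl⟩ : ∃ z, T.mkVertex z = w := ⟨_, mkVertex_out w⟩
  by_cases hy : ∀ a, y.coord a ≠ 0
  · have hg : ∀ x, ¬ T.GlueRel n x (τ, y) := by
      intro x hx
      generalize hz : (τ, y) = z at hx
      cases hx with
      | mk s hs i h0 hi =>
        rw [Prod.ext_iff] at hz
        obtain rfl : y = _ := hz.2
        exact hy _ (coord_onSide_add_two (T.glue s).2 (n - i) (by omega) (by omega))
    have hw : ∀ x, T.mkVertex x = T.mkVertex (τ, y) ↔ x = (τ, y) := fun x => by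
      rw [mkVertex_eq_iff]
      simp [hg]
    rw [sum_fiber_single hw, faceTerm_interior u (τ, y) hy, legMatrix_of_not_onBoundary,
      ← if_congr (hw u.out) rfl rfl, mkVertex_out]
    · ring
    · rintro ⟨s, hs, i, h0, hi, h⟩
      rw [eq_comm, edgeVertex_eq_iff hs] at h
      rw [Prod.ext_iff] at h
      obtain rfl : y = _ := h.2
      exact hy _ (coord_onSide_add_two s.2 i h0 hi)
  push Not at hy
  obtain ⟨a, ha⟩ := hy
  obtain ⟨b, rfl⟩ : ∃ b : ZMod 3, a = b + 2 := ⟨a - 2, by ring⟩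
  obtain ⟨p, h0, hp, rfl⟩ := eq_onSide ha
  by_cases ht : T.IsBoundary (τ, b)
  · have hw : ∀ x, T.mkVertex x = T.mkVertex (τ, onSide b p h0 hp) ↔ x = (τ, onSide b p h0 hp) :=
      fun x => by rw [eq_comm, ← edgeVertex_eq_iff ht]; rfl
    have hE : ∀ s, ¬ T.Enters s (τ, b) := fun s h => (enters_iff.1 h).1 ht
    have hS := legMatrix_edgeVertex u ht p h0 hp
    rw [edgeVertex] at hS
    have hf := faceTerm_onSide hT u (τ, b) p h0 hp
    simp only [hE, false_and, if_false, Finset.sum_const_zero, sub_zero] at hf hS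
    rw [sum_fiber_single hw, hS, hf, ← if_congr (hw u.out) rfl rfl, mkVertex_out]
  · set t : F × ZMod 3 := (τ, b) with htdef
    have hw : ∀ x, T.mkVertex x = T.mkVertex (τ, onSide b p h0 hp) ↔ x = (t.1, onSide t.2 p h0 hp) ∨
        x = ((T.glue t).1, onSide (T.glue t).2 (n - p) (by omega) (by omega)) := by
      intro x
      rw [eq_comm, mkVertex_eq_iff, eq_comm]
      apply or_congr Iff.rfl
      rw [show (τ, onSide b p h0 hp) = (t.1, onSide t.2 p h0 hp) from rfl, glueRel_onSide]
      simp [ht]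
    have hne : (t.1, onSide t.2 p h0 hp) ≠
        ((T.glue t).1, onSide (T.glue t).2 (n - p) (by omega) (by omega)) := by
      intro h
      rw [Prod.mk.injEq] at h
      exact ht (Prod.ext h.1 (onSide_inj h.2).1).symm
    have hnb : ¬ T.OnBoundary (T.mkVertex (τ, onSide b p h0 hp)) := by
      rintro ⟨s, hs, i, h0, hi, h⟩
      obtain ⟨h1, -⟩ := edgeVertex_inj (t := t) hs h.symm
      exact ht (h1 ▸ hs)
    rw [sum_fiber_pair hne hw, legMatrix_of_not_onBoundary u hnb, faceTerm_onSide hT,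
      faceTerm_onSide hT, legEnds, legEnds]
    simp only [exits_glue_iff ht, enters_glue_iff ht, Nat.cast_sub hp.le]
    have hu : (if u.out = (t.1, onSide t.2 p h0 hp) then (1 : ℤ) else 0) +
        (if u.out = ((T.glue t).1, onSide (T.glue t).2 (n - p) (by omega) (by omega)) then 1 else 0)
          = if u = T.mkVertex (τ, onSide b p h0 hp) then 1 else 0 := by
      have := hw u.out
      rw [mkVertex_out] at this
      rw [if_congr this rfl rfl]
      by_cases h1 : u.out = (t.1, onSide t.2 p h0 hp)
      · simp [h1, hne]
      · simp [h1]
    have e1 : ∀ c : ℤ, (n : ℤ) - c = p ↔ c = n - p := by intro c; omega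
    have e2 : ∀ c : ℤ, (n : ℤ) - c = n - p ↔ c = p := by intro c; omega
    simp only [e1, e2]
    linear_combination (-2) * hu

/-! ### Boundary values -/

/-- The value of a function on the small vertices at the `i`-th small vertex of the side `t`, and
`0` if `i` is out of range. -/
def edgeVal (f : T.Vertex n → ℤ) (t : F × ZMod 3) (i : ℕ) : ℤ :=
  if h : 0 < i ∧ i < n then f (T.edgeVertex t i h.1 h.2) else 0

lemma edgeVal_eq (f : T.Vertex n → ℤ) (t : F × ZMod 3) {i : ℕ} (h0 : 0 < i) (hi : i < n) :
    edgeVal f t i = f (T.edgeVertex t i h0 hi) := dif_pos ⟨h0, hi⟩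

/-- On the boundary, `Kbar` is determined by the ends of the legs. -/
lemma Kbar_edgeVertex (hT : T.NoInteriorPuncture) (u : T.Vertex n) {t : F × ZMod 3}
    (ht : T.IsBoundary t) {p : ℕ} (h0 : 0 < p) (hp : p < n) :
    T.Kbar n u (T.edgeVertex t p h0 hp) =
      ∑ i ∈ Finset.range (n + 1), edgeVal (legMatrix T n u) t i * kappa n i p := by
  classical
  have hE : ∀ s, ¬ T.Enters s t := fun s h => (enters_iff.1 h).1 ht
  rw [edgeVertex, Kbar_mkVertex hT]
  simp only [K_onSide]
  rw [skeleton_sum_coord hT u.out t (fun w => kappa n w p) (kappa_zero_left n (by omega))]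
  simp only [hE, and_false, if_false, add_zero]
  have h1 : ∀ i ∈ Finset.range (n + 1), edgeVal (legMatrix T n u) t i * kappa n i p =
      ∑ a, if u.out.2.coord a = i then
        (if T.Exits (u.out.1, a) t then kappa n (u.out.2.coord a) p else 0) else 0 := by
    intro i hi
    by_cases hi' : 0 < i ∧ i < n
    · rw [edgeVal_eq _ _ hi'.1 hi'.2, legMatrix_edgeVertex u ht, legEnds, Finset.sum_mul]
      refine Finset.sum_congr rfl fun a _ => ?_
      by_cases h2 : u.out.2.coord a = i
      · simp [h2]
      · simp [h2]
    · have h2 : edgeVal (legMatrix T n u) t i = 0 := dif_neg hi'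
      rw [h2, zero_mul, Finset.sum_eq_zero]
      intro a _
      split_ifs with h3 h4
      · have := u.out.2.coord_lt a
        have h5 : u.out.2.coord a = 0 := by omega
        rw [h5, kappa_zero_left n (by omega)]
      · rfl
      · rfl
  rw [Finset.sum_congr rfl h1, Finset.sum_comm]
  refine Finset.sum_congr rfl fun a _ => ?_
  have hc : u.out.2.coord a = ((u.out.2.1 a : ℕ) : ℤ) := rfl
  have hlt := (u.out.2.1 a).2
  rw [Finset.sum_eq_single (u.out.2.1 a : ℕ)]
  · rw [if_pos hc]
  · intro i _ hi
    rw [if_neg]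
    omega
  · intro h
    exact absurd (Finset.mem_range.2 (by omega)) h

lemma vecMul_Kbar_edgeVertex [Fintype F] (hT : T.NoInteriorPuncture) (k : T.Vertex n → ℤ)
    {t : F × ZMod 3} (ht : T.IsBoundary t) {p : ℕ} (h0 : 0 < p) (hp : p < n) :
    Matrix.vecMul k (T.Kbar n) (T.edgeVertex t p h0 hp) =
      ∑ i ∈ Finset.range (n + 1), edgeVal (Matrix.vecMul k (legMatrix T n)) t i * kappa n i p := by
  have h1 : ∀ i, edgeVal (Matrix.vecMul k (legMatrix T n)) t i =
      ∑ u, k u * edgeVal (legMatrix T n u) t i := by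
    intro i
    by_cases hi : 0 < i ∧ i < n
    · simp only [edgeVal, dif_pos hi]
      rfl
    · simp [edgeVal, dif_neg hi]
  simp only [h1, Matrix.vecMul, dotProduct, Kbar_edgeVertex hT _ ht, Finset.mul_sum, Finset.sum_mul,
    mul_assoc]
  exact Finset.sum_comm

/-- One leg of a boundary vertex ends there; the other one turns left and ends at the preceding
boundary edge. -/
lemma legMatrix_boundary [DecidableEq (T.Vertex n)] {s t : F × ZMod 3} (hs : T.IsBoundary s)
    (ht : T.IsBoundary t) (hst : T.LeftTurn s t) {i : ℕ} (h0 : 0 < i) (hi : i < n)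
    (w : T.Vertex n) :
    legMatrix T n (T.edgeVertex s i h0 hi) w =
      (if w = T.edgeVertex s i h0 hi then 1 else 0) +
        (if w = T.edgeVertex t (n - i) (by omega) (by omega) then 1 else 0) := by
  classical
  by_cases hw : T.OnBoundary w
  · obtain ⟨t', ht', p, hp0, hp, rfl⟩ := hw
    rw [legMatrix_edgeVertex _ ht', legEnds, edgeVertex_out hs, sum_zmod_three_from s.2]
    simp only [coord_onSide_self, coord_onSide_add_one, coord_onSide_add_two]
    have h1 : T.Exits (s.1, s.2) t' ∧ (i : ℤ) = p ↔
        T.edgeVertex t' p hp0 hp = T.edgeVertex s i h0 hi := by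
      rw [show (s.1, s.2) = s from rfl, exits_iff_of_isBoundary hs]
      constructor
      · rintro ⟨rfl, h⟩
        obtain rfl : i = p := by omega
        rfl
      · intro h
        obtain ⟨rfl, rfl⟩ := edgeVertex_inj ht' h
        simp
    have h2 : T.Exits (s.1, s.2 + 1) t' ∧ (n : ℤ) - i = p ↔
        T.edgeVertex t' p hp0 hp = T.edgeVertex t (n - i) (by omega) (by omega) := by
      rw [show (s.1, s.2 + 1) = left s from rfl, ← leftTurn_iff_exits]
      constructor
      · rintro ⟨h, h'⟩
        obtain rfl := h.eq_of_isBoundary hst ht' ht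
        obtain rfl : n - i = p := by omega
        rfl
      · intro h
        obtain ⟨rfl, rfl⟩ := edgeVertex_inj ht' h
        refine ⟨hst, ?_⟩
        omega
    have h3 : ¬ (T.Exits (s.1, s.2 + 2) t' ∧ (0 : ℤ) = p) := by
      rintro ⟨-, h⟩
      omega
    simp only [h1, h2, h3, if_false, add_zero]
  · rw [legMatrix_of_not_onBoundary _ hw, if_neg, if_neg]
    · rfl
    · rintro rfl
      exact hw ⟨t, ht, _, _, _, rfl⟩
    · rintro rfl
      exact hw ⟨s, hs, _, _, _, rfl⟩

/-! ### The boundary lattice -/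

/-- The boundary-symmetric vectors are those which are supported on the boundary and are invariant
under passing from a boundary edge to the preceding one and reversing. -/
lemma mem_LambdaBoundary_iff (hspecial : T.IsSpecial) {k : T.Vertex n → ℤ} :
    k ∈ T.LambdaBoundary n ↔ (∀ x, ¬ T.OnBoundary x → k x = 0) ∧
      ∀ s t, T.IsBoundary s → T.IsBoundary t → T.LeftTurn s t →
        ∀ i, 0 < i → i < n → edgeVal k s i = edgeVal k t (n - i) := by
  refine and_congr_right fun _ => ⟨fun h s t hs ht hst i h0 hi => ?_, fun h r e he => ?_⟩
  · obtain ⟨r, e, he, ⟨j, rfl⟩, -, -⟩ := hspecial t ht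
    obtain ⟨hr, -, heb, hel⟩ := id he
    obtain rfl := hst.source_eq (hel j) hs (heb _)
    have : NeZero r := ⟨hr.ne'⟩
    obtain ⟨J, J', hJ, hJr, hJ', hJr', e1, e2, h3⟩ : ∃ J J' : ℕ, 1 ≤ J ∧ J ≤ r ∧ 1 ≤ J' ∧ J' ≤ r ∧
        (J : ZMod r) = j ∧ (J' : ZMod r) = j + 1 ∧ (J' = J + 1 ∨ (J = r ∧ J' = 1)) := by
      have hv : ((j.val : ℕ) : ZMod r) = j := ZMod.natCast_zmod_val j
      have hlt := ZMod.val_lt j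
      by_cases h1 : j.val = 0
      · have hj : j = 0 := by rw [← hv, h1, Nat.cast_zero]
        exact ⟨r, 1, hr, le_rfl, le_rfl, hr, by simp [hj], by simp [hj], .inr ⟨rfl, rfl⟩⟩
      · exact ⟨j.val, j.val + 1, by omega, by omega, by omega, by omega, hv, by simp, .inl rfl⟩
    rw [edgeVal_eq _ _ h0 hi, edgeVal_eq _ _ (by omega : 0 < n - i) (by omega)]
    rcases Nat.even_or_odd r with hev | hodd
    · obtain ⟨a, ha⟩ := (h r e he).1 hev
      have h4 := ha J' hJ' hJr' i h0 hi
      have h5 := ha J hJ hJr (n - i) (by omega) (by omega)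
      rw [e2] at h4
      rw [e1] at h5
      rw [h4, h5, Nat.sub_sub_self hi.le]
      rcases h3 with rfl | ⟨rfl, rfl⟩
      · rcases Nat.even_or_odd J with hJe | hJo
        · rw [if_pos hJe.add_one, if_neg (Nat.not_odd_iff_even.2 hJe)]
        · rw [if_neg (Nat.not_odd_iff_even.2 hJo.add_one), if_pos hJo]
      · rw [if_pos odd_one, if_neg (Nat.not_odd_iff_even.2 hev)]
    · obtain ⟨b, hb, hb'⟩ := (h r e he).2 hodd
      have h4 := hb' J' hJ' hJr' i h0 hi
      have h5 := hb' J hJ hJr (n - i) (by omega) (by omega)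
      rw [e2] at h4
      rw [e1] at h5
      rw [h4, h5, hb i h0 hi]
  · obtain ⟨hr, -, heb, hel⟩ := id he
    have hstep : ∀ (j : ℕ) (i : ℕ), 0 < i → i < n →
        edgeVal k (e ((j + 1 : ℕ) : ZMod r)) i =
          if Odd (j + 1) then edgeVal k (e ((1 : ℕ) : ZMod r)) i
          else edgeVal k (e ((1 : ℕ) : ZMod r)) (n - i) := by
      intro j
      induction j with
      | zero => simp
      | succ j ih =>
        intro i h0 hi
        have h1 := hel ((j + 1 : ℕ) : ZMod r)
        rw [← Nat.cast_succ] at h1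
        rw [h _ _ (heb _) (heb _) h1 i h0 hi, ih (n - i) (by omega) (by omega),
          Nat.sub_sub_self hi.le]
        rcases Nat.even_or_odd (j + 1) with hJe | hJo
        · rw [if_pos hJe.add_one, if_neg (Nat.not_odd_iff_even.2 hJe)]
        · rw [if_neg (Nat.not_odd_iff_even.2 hJo.add_one), if_pos hJo]
    have hstep' : ∀ j : ℕ, 1 ≤ j → ∀ (i : ℕ) (h0 : 0 < i) (hi : i < n),
        k (T.edgeVertex (e j) i h0 hi) =
          if Odd j then edgeVal k (e ((1 : ℕ) : ZMod r)) i
          else edgeVal k (e ((1 : ℕ) : ZMod r)) (n - i) := by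
      intro j hj i h0 hi
      obtain ⟨j, rfl⟩ : ∃ l, j = l + 1 := ⟨j - 1, by omega⟩
      rw [← edgeVal_eq k (e ((j + 1 : ℕ) : ZMod r)) h0 hi, hstep j i h0 hi]
    refine ⟨fun _ => ⟨edgeVal k (e ((1 : ℕ) : ZMod r)), fun j hj _ => hstep' j hj⟩, fun hodd => ?_⟩
    have hsym : ∀ i, 0 < i → i < n → edgeVal k (e ((1 : ℕ) : ZMod r)) i =
        edgeVal k (e ((1 : ℕ) : ZMod r)) (n - i) := by
      intro i h0 hi
      have h1 := hstep r i h0 hi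
      rw [if_neg (Nat.not_odd_iff_even.2 hodd.add_one), Nat.cast_add, ZMod.natCast_self,
        zero_add] at h1
      exact h1
    refine ⟨edgeVal k (e ((1 : ℕ) : ZMod r)), hsym, fun j hj _ i h0 hi => ?_⟩
    rw [hstep' j hj i h0 hi, ← hsym i h0 hi, ite_self]

/-- For boundary-symmetric vectors, both legs of the boundary vertices contribute equally. -/
lemma vecMul_legMatrix_of_mem_LambdaBoundary [Fintype F] (hT : T.NoInteriorPuncture)
    (hspecial : T.IsSpecial) {k : T.Vertex n → ℤ} (hk : k ∈ T.LambdaBoundary n) :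
    Matrix.vecMul k (legMatrix T n) = 2 • k := by
  classical
  obtain ⟨hk0, hk1⟩ := (mem_LambdaBoundary_iff hspecial).1 hk
  ext w
  by_cases hw : T.OnBoundary w
  · obtain ⟨t, ht, p, h0, hp, rfl⟩ := hw
    obtain ⟨r, e, ⟨-, -, heb, hel⟩, ⟨j, rfl⟩, -, -⟩ := hspecial t ht
    -- the edge following `e j` is the only one with a left-turning leg that ends at `e j`
    set s := e (j + 1)
    have hs : T.IsBoundary s := heb _
    have hst : T.LeftTurn s (e j) := hel j
    have h1 : ∀ u, k u * legMatrix T n u (T.edgeVertex (e j) p h0 hp) =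
        k u * (if u = T.edgeVertex (e j) p h0 hp then 1 else 0) +
          k u * (if u = T.edgeVertex s (n - p) (by omega) (by omega) then 1 else 0) := by
      intro u
      by_cases hu : T.OnBoundary u
      · obtain ⟨s', hs', i, hi0, hi, rfl⟩ := hu
        obtain ⟨t', hst', ht'⟩ := hT s'
        rw [legMatrix_boundary hs' ht' hst', mul_add]
        congr 3
        · exact propext eq_comm
        · refine propext ⟨fun h => ?_, fun h => ?_⟩
          · obtain ⟨rfl, rfl⟩ := edgeVertex_inj ht h
            obtain rfl := hst.source_eq hst' hs hs'
            simp only [Nat.sub_sub_self hi.le]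
          · obtain ⟨rfl, rfl⟩ := edgeVertex_inj hs' h
            obtain rfl := hst.eq_of_isBoundary hst' ht ht'
            simp only [Nat.sub_sub_self hp.le]
      · rw [hk0 u hu]
        simp
    have h2 := hk1 s (e j) hs ht hst (n - p) (by omega) (by omega)
    rw [edgeVal_eq _ _ (by omega : 0 < n - p) (by omega), Nat.sub_sub_self hp.le,
      edgeVal_eq _ _ h0 hp] at h2
    simp only [Matrix.vecMul, dotProduct, h1, Finset.sum_add_distrib, mul_ite, mul_one, mul_zero,
      Finset.sum_ite_eq', Finset.mem_univ, if_true, h2, Pi.smul_apply]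
    rw [two_nsmul]
  · simp [Matrix.vecMul, dotProduct, legMatrix_of_not_onBoundary _ hw, hk0 w hw]

/-! ### Divisibility conditions on `Pbar` -/

section Pbar

variable [Fintype F]

lemma Qbar_transpose : (T.Qbar n).transpose = -T.Qbar n := by
  classical
  ext u v
  simp only [Matrix.transpose_apply, Matrix.neg_apply, Qbar, ← Finset.sum_neg_distrib]
  refine Finset.sum_congr rfl fun τ _ => ?_
  rw [Finset.sum_comm]
  refine Finset.sum_congr rfl fun x _ => Finset.sum_congr rfl fun y _ => ?_
  have : SmallVertex.Q y x = -SmallVertex.Q x y := by simp [SmallVertex.Q]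
  rw [this, if_congr and_comm rfl rfl]
  split_ifs <;> simp

lemma Pbar_transpose : (T.Pbar n).transpose = -T.Pbar n := by
  rw [Pbar, Matrix.transpose_mul, Matrix.transpose_mul, Matrix.transpose_transpose, Qbar_transpose,
    Matrix.neg_mul, Matrix.mul_neg, Matrix.mul_assoc]

lemma Pbar_mulVec (hT : T.NoInteriorPuncture) (k : T.Vertex n → ℤ) (u : T.Vertex n) :
    (T.Pbar n).mulVec k u = n * ((legMatrix T n).mulVec (Matrix.vecMul k (T.Kbar n)) u -
      2 * Matrix.vecMul k (T.Kbar n) u) := by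
  classical
  rw [Pbar, ← Matrix.mulVec_mulVec, Matrix.mulVec_transpose, Kbar_mul_Qbar hT, Matrix.smul_mulVec,
    Matrix.sub_mulVec, Matrix.ofNat_mulVec]
  simp

lemma Pbar_mulVec_of_mem_LambdaBoundary (hT : T.NoInteriorPuncture) (hspecial : T.IsSpecial)
    {k : T.Vertex n → ℤ} (hk : k ∈ T.LambdaBoundary n) : (T.Pbar n).mulVec k = 0 := by
  classical
  rw [← Matrix.vecMul_transpose, Pbar_transpose, Pbar, Kbar_mul_Qbar hT, Matrix.vecMul_neg,
    ← Matrix.vecMul_vecMul, Matrix.vecMul_smul, Matrix.vecMul_sub,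
    vecMul_legMatrix_of_mem_LambdaBoundary hT hspecial hk]
  have h : Matrix.vecMul k (2 : Matrix (T.Vertex n) (T.Vertex n) ℤ) = 2 • k := by
    rw [Matrix.vecMul_ofNat]
    ext v
    simp [mul_comm]
  rw [h, sub_self, smul_zero, Matrix.zero_vecMul, neg_zero]

/-- Modulo an odd number, a solution of `S L ≡ 2 L` is determined by its values on the boundary. -/
lemma forall_dvd_of_forall_boundary_dvd {m : ℕ} (hm : Odd m) {L : T.Vertex n → ℤ}
    (h : ∀ u, (m : ℤ) ∣ (legMatrix T n).mulVec L u - 2 * L u)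
    (hL : ∀ w, T.OnBoundary w → (m : ℤ) ∣ L w) (u : T.Vertex n) : (m : ℤ) ∣ L u := by
  have h1 : (m : ℤ) ∣ (legMatrix T n).mulVec L u := by
    refine Finset.dvd_sum fun w _ => ?_
    by_cases hw : T.OnBoundary w
    · exact Dvd.dvd.mul_left (hL w hw) _
    · change (m : ℤ) ∣ legMatrix T n u w * L w
      rw [legMatrix_of_not_onBoundary u hw, zero_mul]
      exact dvd_zero _
  have h2 : (m : ℤ) ∣ 2 * L u := (dvd_sub_right h1).1 (h u)
  refine IsCoprime.dvd_of_dvd_mul_left ?_ h2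
  exact_mod_cast Nat.isCoprime_iff_coprime.2 (Nat.coprime_two_right.2 hm)

end Pbar

/-! ### Averaging along the boundary components -/

section Average

/-- The relation between a boundary edge and the preceding one, with the direction of the edge
reversed. -/
def BoundaryStep (T : IdealTriangulation F) (x y : (F × ZMod 3) × Bool) : Prop :=
  T.IsBoundary x.1 ∧ T.IsBoundary y.1 ∧ T.LeftTurn x.1 y.1 ∧ y.2 = !x.2

/-- A chosen representative of the directed boundary edges which are related by iterated
boundary steps. -/
noncomputable def boundaryRep (T : IdealTriangulation F) (x : (F × ZMod 3) × Bool) :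
    (F × ZMod 3) × Bool :=
  (Quotient.mk (Relation.EqvGen.setoid T.BoundaryStep) x).out

lemma boundaryRep_eq {x y : (F × ZMod 3) × Bool} (h : T.BoundaryStep x y) :
    T.boundaryRep x = T.boundaryRep y :=
  congrArg Quotient.out (Quotient.sound (s := Relation.EqvGen.setoid T.BoundaryStep) (.rel _ _ h))

lemma eqvGen_boundaryRep (x : (F × ZMod 3) × Bool) :
    Relation.EqvGen T.BoundaryStep (T.boundaryRep x) x :=
  Quotient.mk_out (s := Relation.EqvGen.setoid T.BoundaryStep) x

/-- The values of `c` along a directed edge. -/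
def directed (n : ℕ) (c : F × ZMod 3 → ℕ → ℤ) (x : (F × ZMod 3) × Bool) (i : ℕ) : ℤ :=
  if x.2 then c x.1 (n - i) else c x.1 i

lemma sum_directed_true (c : F × ZMod 3 → ℕ → ℤ) (x : F × ZMod 3) (p : ℤ) :
    ∑ i ∈ Finset.range (n + 1), directed n c (x, true) i * kappa n i p =
      ∑ i ∈ Finset.range (n + 1), c x i * kappa n i (n - p) := by
  rw [← Finset.sum_range_reflect]
  refine Finset.sum_congr rfl fun i hi => ?_
  have hi' : i ≤ n := by simpa [Nat.lt_succ_iff] using hi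
  have h := kappa_sub_sub n i (n - p)
  rw [sub_sub_cancel] at h
  rw [directed, if_pos rfl, Nat.add_sub_cancel, Nat.sub_sub_self hi', Nat.cast_sub hi', h]

/-- If `k Kbar` is boundary-symmetric modulo an odd number `m`, then on the boundary it is congruent
to `k' Kbar` for a boundary-symmetric vector `k'`. -/
lemma exists_mem_LambdaBoundary [Fintype F] (hT : T.NoInteriorPuncture) (hspecial : T.IsSpecial)
    {m : ℕ} (hm : Odd m) (k : T.Vertex n → ℤ)
    (hk : ∀ s t, T.IsBoundary s → T.IsBoundary t → T.LeftTurn s t → ∀ i, 0 < i → i < n →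
      (m : ℤ) ∣ edgeVal (Matrix.vecMul k (T.Kbar n)) s i -
        edgeVal (Matrix.vecMul k (T.Kbar n)) t (n - i)) :
    ∃ k' ∈ T.LambdaBoundary n, ∀ w, T.OnBoundary w →
      (m : ℤ) ∣ Matrix.vecMul k (T.Kbar n) w - Matrix.vecMul k' (T.Kbar n) w := by
  set L := Matrix.vecMul k (T.Kbar n) with hL
  set c : F × ZMod 3 → ℕ → ℤ := edgeVal (Matrix.vecMul k (legMatrix T n)) with hc
  -- `h + 1` is the inverse of `2` modulo `m`
  obtain ⟨h, hh⟩ := hm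
  set D : (F × ZMod 3) × Bool → ℕ → ℤ := fun x => directed n c (T.boundaryRep x) with hD
  set M : (F × ZMod 3) × Bool → ℕ → ℤ := fun x p =>
    ∑ i ∈ Finset.range (n + 1), directed n c x i * kappa n i p with hM
  -- one factor `1 / 2` averages over the two directions of an edge, and the other one accounts for
  -- `k' S = 2 k'`
  set d : F × ZMod 3 → ℕ → ℤ := fun s i =>
    (h + 1) ^ 2 * (D (s, false) i + D (s, true) (n - i)) with hd
  have hMf : ∀ s, T.IsBoundary s → ∀ p, 0 < p → p < n → M (s, false) p = edgeVal L s p := by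
    intro s hs p h0 hp
    rw [edgeVal_eq L s h0 hp, hL, vecMul_Kbar_edgeVertex hT k hs h0 hp]
    rfl
  have hMt : ∀ s, T.IsBoundary s → ∀ p, 0 < p → p < n → M (s, true) p = edgeVal L s (n - p) := by
    intro s hs p h0 hp
    rw [edgeVal_eq L s (by omega : 0 < n - p) (by omega), hL,
      vecMul_Kbar_edgeVertex hT k hs (by omega) (by omega), hM]
    simp only
    rw [sum_directed_true, Nat.cast_sub hp.le]
  have hstep : ∀ x y, Relation.EqvGen T.BoundaryStep x y → ∀ p, 0 < p → p < n →
      (m : ℤ) ∣ M x p - M y p := by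
    intro x y hxy p h0 hp
    induction hxy with
    | rel x y hxy =>
      obtain ⟨s, b⟩ := x
      obtain ⟨t, b'⟩ := y
      obtain ⟨hs, ht, hst, rfl⟩ := hxy
      cases b with
      | false =>
        rw [hMf s hs p h0 hp, Bool.not_false, hMt t ht p h0 hp]
        exact hk s t hs ht hst p h0 hp
      | true =>
        rw [hMt s hs p h0 hp, Bool.not_true, hMf t ht p h0 hp]
        have := hk s t hs ht hst (n - p) (by omega) (by omega)
        rwa [Nat.sub_sub_self hp.le] at this
    | refl x => simp
    | symm x y _ ih => rw [← neg_sub]; exact ih.neg_right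
    | trans x y z _ _ h1 h2 => simpa using dvd_add h1 h2
  have hmem : extendBoundary d ∈ T.LambdaBoundary n := by
    rw [mem_LambdaBoundary_iff hspecial]
    refine ⟨fun x hx => extendBoundary_of_not_onBoundary d hx, fun s t hs ht hst i h0 hi => ?_⟩
    rw [edgeVal_eq _ _ h0 hi, edgeVal_eq _ _ (by omega : 0 < n - i) (by omega),
      extendBoundary_edgeVertex d hs, extendBoundary_edgeVertex d ht]
    have h1 : D (s, false) = D (t, true) :=
      congrArg (directed n c) (boundaryRep_eq ⟨hs, ht, hst, rfl⟩)
    have h2 : D (s, true) = D (t, false) :=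
      congrArg (directed n c) (boundaryRep_eq ⟨hs, ht, hst, rfl⟩)
    simp only [hd, h1, h2, Nat.sub_sub_self hi.le]
    ring
  refine ⟨extendBoundary d, hmem, ?_⟩
  rintro w ⟨s, hs, p, h0, hp, rfl⟩
  have h1 : Matrix.vecMul (extendBoundary d) (T.Kbar n) (T.edgeVertex s p h0 hp) =
      2 * (h + 1) ^ 2 * (M (T.boundaryRep (s, false)) p + M (T.boundaryRep (s, true)) (n - p)) := by
    rw [vecMul_Kbar_edgeVertex hT _ hs, vecMul_legMatrix_of_mem_LambdaBoundary hT hspecial hmem]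
    have h2 : M (T.boundaryRep (s, true)) (n - p) =
        ∑ i ∈ Finset.range (n + 1), D (s, true) (n - i) * kappa n i p := by
      have := sum_directed_true (n := n) (fun _ => D (s, true)) s p
      simp only [directed, if_true] at this
      rw [this, ← Nat.cast_sub hp.le]
    rw [h2, ← Finset.sum_add_distrib, Finset.mul_sum]
    refine Finset.sum_congr rfl fun i hin => ?_
    by_cases hi : 0 < i ∧ i < n
    · rw [edgeVal_eq _ _ hi.1 hi.2, Pi.smul_apply, extendBoundary_edgeVertex d hs hi.1 hi.2]
      simp only [hd, hD]
      ring
    · have hκ : kappa n i p = 0 := by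
        rw [Finset.mem_range] at hin
        rcases (by omega : i = 0 ∨ i = n) with rfl | rfl
        · exact kappa_zero_left n (by omega)
        · rw [kappa, min_eq_right (by omega), sub_self]
      simp only [hκ, mul_zero, add_zero]
  have h2 := hstep _ _ (eqvGen_boundaryRep (s, false)) p h0 hp
  have h3 := hstep _ _ (eqvGen_boundaryRep (s, true)) (n - p) (by omega) (by omega)
  rw [hMf s hs p h0 hp] at h2
  rw [hMt s hs (n - p) (by omega) (by omega), Nat.sub_sub_self hp.le] at h3
  rw [edgeVal_eq L s h0 hp] at h2 h3
  rw [h1]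
  obtain ⟨x, hx⟩ := h2
  obtain ⟨y, hy⟩ := h3
  refine ⟨-(2 * (h + 1) ^ 2 * (x + y)) - (2 * h + 3) * L (T.edgeVertex s p h0 hp), ?_⟩
  rw [sub_eq_iff_eq_add] at hx hy
  rw [hx, hy, hh]
  push_cast
  ring

end Average

/-! ### The lattice of central exponents -/

section Lattice

variable [Fintype F]

lemma dvd_mul_iff_dvd_div_gcd {n m : ℕ} (hm : 0 < m) (x : ℤ) :
    (m : ℤ) ∣ n * x ↔ ((m / n.gcd m : ℕ) : ℤ) ∣ x := by
  have hg : 0 < n.gcd m := Nat.gcd_pos_of_pos_right _ hm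
  have hco := Nat.coprime_div_gcd_div_gcd hg
  obtain ⟨a, ha⟩ := Nat.gcd_dvd_left n m
  obtain ⟨b, hb⟩ := Nat.gcd_dvd_right n m
  have ha' : n / n.gcd m = a := Nat.div_eq_of_eq_mul_right hg ha
  have hb' : m / n.gcd m = b := Nat.div_eq_of_eq_mul_right hg hb
  rw [ha', hb'] at hco
  rw [hb']
  have hg' : ((n.gcd m : ℕ) : ℤ) ≠ 0 := by omega
  have h1 : (m : ℤ) ∣ n * x ↔ (b : ℤ) ∣ a * x := by
    have hn : (n : ℤ) = n.gcd m * a := by exact_mod_cast ha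
    have hm : (m : ℤ) = n.gcd m * b := by exact_mod_cast hb
    generalize ((n.gcd m : ℕ) : ℤ) = g at *
    rw [hn, hm, mul_assoc, mul_dvd_mul_iff_left hg']
  rw [h1]
  have hco' : IsCoprime (b : ℤ) a := Nat.isCoprime_iff_coprime.2 hco.symm
  exact ⟨hco'.dvd_of_dvd_mul_left, fun h => h.mul_left _⟩

/-- The exponents of the central monomials form the lattice generated by `LambdaMod` and
`LambdaBoundary`. -/
theorem forall_dvd_iff_mem_LambdaZ (hT : T.NoInteriorPuncture) (hspecial : T.IsSpecial)
    (hn : n ≠ 0) {m : ℕ} (hm : Odd m) (k : T.Vertex n → ℤ) :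
    (∀ u, (m : ℤ) ∣ (legMatrix T n).mulVec (Matrix.vecMul k (T.Kbar n)) u -
      2 * Matrix.vecMul k (T.Kbar n) u) ↔ k ∈ T.LambdaZ n m := by
  classical
  have hbd : ∀ k ∈ T.LambdaBoundary n, ∀ u, (legMatrix T n).mulVec (Matrix.vecMul k (T.Kbar n)) u -
      2 * Matrix.vecMul k (T.Kbar n) u = 0 := by
    intro k hk u
    have h := congrFun (Pbar_mulVec_of_mem_LambdaBoundary hT hspecial hk) u
    rw [Pbar_mulVec hT] at h
    exact (mul_eq_zero.1 h).resolve_left (by exact_mod_cast hn)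
  constructor
  · intro h
    obtain ⟨k', hk', hkk'⟩ := exists_mem_LambdaBoundary hT hspecial hm k (by
      intro s t hs ht hst i h0 hi
      have h1 := h (T.edgeVertex s i h0 hi)
      rw [edgeVal_eq _ _ h0 hi, edgeVal_eq _ _ (by omega : 0 < n - i) (by omega)]
      simp only [Matrix.mulVec, dotProduct, legMatrix_boundary hs ht hst h0 hi, add_mul, ite_mul,
        one_mul, zero_mul, Finset.sum_add_distrib, Finset.sum_ite_eq', Finset.mem_univ,
        if_true] at h1
      rw [← dvd_neg]
      exact h1.trans (dvd_of_eq (by ring)))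
    have h2 : k - k' ∈ T.LambdaMod n m := by
      apply forall_dvd_of_forall_boundary_dvd hm
      · intro u
        rw [Matrix.sub_vecMul, Matrix.mulVec_sub]
        have h3 := hbd k' hk' u
        have h4 := h u
        simp only [Pi.sub_apply]
        rw [← sub_zero (_ - 2 * Matrix.vecMul k (T.Kbar n) u), ← h3] at h4
        refine h4.trans (dvd_of_eq ?_)
        ring
      · intro w hw
        rw [Matrix.sub_vecMul]
        exact hkk' w hw
    rw [← sub_add_cancel k k']
    exact add_mem (AddSubgroup.subset_closure (.inl h2)) (AddSubgroup.subset_closure (.inr hk'))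
  · intro h
    induction h using AddSubgroup.closure_induction with
    | mem k hk =>
      intro u
      rcases hk with hk | hk
      · refine dvd_sub (Finset.dvd_sum fun w _ => ?_) (Dvd.dvd.mul_left (hk u) _)
        exact Dvd.dvd.mul_left (hk w) _
      · rw [hbd k hk u]
        exact dvd_zero _
    | zero => simp
    | add x y _ _ hx hy =>
      intro u
      have := dvd_add (hx u) (hy u)
      rw [Matrix.add_vecMul, Matrix.mulVec_add]
      refine this.trans (dvd_of_eq ?_)
      simp only [Pi.add_apply]
      ring
    | neg x _ hx =>
      intro u
      have := (hx u).neg_right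
      rw [Matrix.neg_vecMul, Matrix.mulVec_neg]
      refine this.trans (dvd_of_eq ?_)
      simp only [Pi.neg_apply]
      ring

end Lattice

end IdealTriangulation

theorem theorem6 {F : Type*} [Fintype F] (T : IdealTriangulation F)
    (hint : T.NoInteriorPuncture) (hbord : T.EssentiallyBordered) (hspecial : T.IsSpecial)
    (n : ℕ) (hn : 2 ≤ n) {R : Type*} [CommRing R] [IsDomain R] (q : Rˣ)
    (m'' d' m' : ℕ) (hq : IsPrimitiveRoot ((q : R) ^ 2) m'') (hodd : Odd m'')
    (hd' : d' = Nat.gcd n m'') (hm' : m' = m'' / d') :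
    Subalgebra.toSubmodule (Subalgebra.center R (T.ReducedATorus n q)) =
      Submodule.span R (QuantumTorus.weyl q (T.Pbar n) '' (T.LambdaZ n m' : Set (T.Vertex n → ℤ))) := by
  have hm0 : 0 < m'' := hodd.pos
  have hm'odd : Odd m' := by
    rw [hm', hd']
    exact hodd.of_dvd_nat (Nat.div_dvd_of_dvd (Nat.gcd_dvd_right n m''))
  have hq' : IsPrimitiveRoot (q ^ 2) m'' := by
    rw [← IsPrimitiveRoot.coe_units_iff]
    exact_mod_cast hq
  rw [QuantumTorus.center_eq_span q _ IdealTriangulation.Pbar_transpose]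
  congr 2
  ext k
  rw [Set.mem_ofPred_eq, SetLike.mem_coe,
    ← IdealTriangulation.forall_dvd_iff_mem_LambdaZ hint hspecial (by omega) hm'odd k]
  refine forall_congr' fun v => ?_
  rw [zpow_mul, zpow_ofNat, hq'.zpow_eq_one_iff_dvd, IdealTriangulation.Pbar_mulVec hint,
    IdealTriangulation.dvd_mul_iff_dvd_div_gcd hm0, hm', hd']
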